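/- **Model.** There are $n$ processors with identities $1,\dots,n$ and an integer $0<t<n$. Each processor has a fixed input bit, a write-once output bit with values in $\{\bot,0,1\}$ (initially $\bot$), a counter of its resets, and a memory, initially blank. Memory contents and messages range over arbitrary sets. A *configuration* lists the states of all processors (and the message buffer). There are three kinds of steps. In a *sending step* a processor puts into the buffer one (possibly empty) message for each processor, determined by its current state; a second sending step with no receiving or resetting step of that processor in between has no effect. In a *receiving step* a message in the buffer is delivered to its recipient, which knows the sender and samples, from a discrete probability distribution that depends on its identity, its state, the sender and the message, a new memory content and possibly a value to write to its output bit. A *resetting step* makes the memory of a processor blank, keeps its input and output bits, and increments its reset counter. An *algorithm* specifies the blank memory, the messages and these distributions. A *partial execution* is an assignment of input bits followed by finitely many steps with their resulting configurations; its probability is the product of the probabilities of its transitions. An *acceptable window* is a sequence of steps of the following form: all $n$ processors take a sending step; then, for some sets $S_1,\dots,S_n\subseteq[n]$ of size at least $n-t$, each processor $i$ receives, in some order, the messages just sent to it by the processors in $S_i$; then at most $t$ resetting steps occur. A *strongly adaptive adversary* is a deterministic function from partial executions to next steps such that every infinite execution it produces is a concatenation of acceptable windows. A configuration is *reachable* if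 it results from a partial execution of non-zero probability that is a concatenation of acceptable windows. An algorithm achieves *measure one correctness* if in every reachable configuration all output bits different from $\bot$ agree with each other and are equal to the input bit of some processor. It achieves *measure one termination* if, for every strongly adaptive adversary and all inputs, the probability that some processor never writes its output bit is $0$. The *running time* of an execution is the number of acceptable windows that pass before the first processor decides (writes its output bit). **Theorem.** For every constant $c>0$ there are constants $C,\alpha>0$, depending only on $c$, such that the following holds for all $n$ and $t=\lfloor cn\rfloor$ with $0<t<n$. For every algorithm for $n$ processors that achieves measure one correctness and measure one termination (with respect to $t$), there are a strongly adaptive adversary and a setting of the input bits such that, with probability at least $\tfrac12$, the running time is at least $C e^{\alpha n}$. -/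

import Mathlib

open scoped ENNReal Topology

namespace AsyncAgreement

/-- The local state of a processor in an `n`-processor system (its identity is the index under
which the state is stored): its fixed input bit, its write-once output bit (`none` stands for `⊥`),
the number of times it has been reset, its memory contents, and a flag recording whether it has
already taken a sending step since the last event (receiving or resetting step) it experienced. -/
structure ProcState (Mem : Type*) where
  input : Bool
  output : Option Bool
  resets : ℕ
  mem : Mem
  sent : Bool

/-- A randomized message-passing algorithm for `n` processors.

* `blank` is the content of an erased memory; it is also the memory content at the beginning.
* `message i s j` is what processor `i`, in state `s`, sends to processor `j` when it takes a
  sending step. This is deterministic: randomness is sampled only in response to received messages,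
  and outgoing messages sampled at that moment are part of the memory until they are sent.
* `receive i s j m` is the distribution according to which processor `i`, in state `s`, on receiving
  `m` from processor `j`, samples its new memory and, possibly, a value to write to its output bit
  (`none`: nothing is written). Writing has an effect only if the output bit is still `⊥`.

`Msg` is the space of message contents. A processor that chooses not to send anything to `j` sends
it some distinguished element of `Msg` (the empty message). -/
structure Algorithm (n : ℕ) (Mem Msg : Type*) where
  blank : Mem
  message : Fin n → ProcState Mem → Fin n → Msg
  receive : Fin n → ProcState Mem → Fin n → Msg → PMF (Mem × Option Bool)

/-- The states of all processors, together with the message buffer: `buffer j i` is the latest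
message sent by `j` to `i`, if it has not been delivered. (Within acceptable windows only messages
that were just sent are ever delivered, so older messages need not be kept.) -/
structure Config (n : ℕ) (Mem Msg : Type*) where
  state : Fin n → ProcState Mem
  buffer : Fin n → Fin n → Option Msg

/-- No processor has decided. -/
def Config.Undecided {n : ℕ} {Mem Msg : Type*} (c : Config n Mem Msg) : Prop :=
  ∀ i, (c.state i).output = none

/-- The three kinds of steps. `receive i j` delivers to `i` the message just sent to it by `j`. -/
inductive Step (n : ℕ) where
  | send (i : Fin n)
  | receive (i j : Fin n)
  | reset (i : Fin n)

/-- Partial executions: an initial input assignment followed by finitely many steps, each recorded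
together with the configuration it results in. -/
inductive Exec (n : ℕ) (Mem Msg : Type*) where
  | start (inputs : Fin n → Bool)
  | snoc (e : Exec n Mem Msg) (s : Step n) (c : Config n Mem Msg)

/-- The sequence of steps of a partial execution, in chronological order. -/
def Exec.schedule {n : ℕ} {Mem Msg : Type*} : Exec n Mem Msg → List (Step n)
  | .start _ => []
  | .snoc e s _ => e.schedule ++ [s]

/-- `p.IsPrefix e`: the partial execution `p` is an initial part of the partial execution `e`. -/
inductive Exec.IsPrefix {n : ℕ} {Mem Msg : Type*} : Exec n Mem Msg → Exec n Mem Msg → Prop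
  | refl (e : Exec n Mem Msg) : Exec.IsPrefix e e
  | snoc {p e : Exec n Mem Msg} (s : Step n) (c : Config n Mem Msg) (h : Exec.IsPrefix p e) :
      Exec.IsPrefix p (.snoc e s c)

/-- An acceptable window: all `n` processors take sending steps; then, for sets `S i` of at least
`n - t` processors, each processor `i` receives (in any order and interleaving) the messages just
sent to it by the processors in `S i`; then at most `t` resetting steps occur. -/
def IsAcceptableWindow {n : ℕ} (t : ℕ) (w : List (Step n)) : Prop :=
  ∃ (snd : List (Fin n)) (S : Fin n → Finset (Fin n)) (rcv : List (Fin n × Fin n))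
    (rst : List (Fin n)),
    snd.Nodup ∧ (∀ i, i ∈ snd) ∧
    (∀ i, n ≤ (S i).card + t) ∧
    rcv.Nodup ∧ (∀ i j, (i, j) ∈ rcv ↔ j ∈ S i) ∧
    rst.length ≤ t ∧
    w = snd.map Step.send ++ rcv.map (fun p => Step.receive p.1 p.2) ++ rst.map Step.reset

/-- The list of steps `l` is a concatenation of `m` acceptable windows. -/
def IsWindowSeq {n : ℕ} (t m : ℕ) (l : List (Step n)) : Prop :=
  ∃ ws : List (List (Step n)),
    ws.length = m ∧ (∀ w ∈ ws, IsAcceptableWindow t w) ∧ ws.flatten = l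

/-- An adversary: a deterministic function from partial executions (with full information on all
states and messages) to the next step. -/
abbrev Adversary (n : ℕ) (Mem Msg : Type*) := Exec n Mem Msg → Step n

namespace Algorithm

variable {n : ℕ} {Mem Msg : Type*} (A : Algorithm n Mem Msg)

/-- The initial configuration for given input bits. -/
def initial (inputs : Fin n → Bool) : Config n Mem Msg where
  state i := { input := inputs i, output := none, resets := 0, mem := A.blank, sent := false }
  buffer _ _ := none

/-- The configuration reached at the end of a partial execution. -/
def last : Exec n Mem Msg → Config n Mem Msg
  | .start inputs => A.initial inputs
  | .snoc _ _ c => c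

/-- The distribution of the configuration resulting from a step.

* A sending step places new messages in the buffer, unless the processor has already sent its
  complete response to prior events; in that case it has no effect.
* A receiving step delivers a message; the recipient samples its new memory and possibly writes its
  output bit, if this is not yet written. (Steps delivering a message that is not there are without
  effect; they never occur within acceptable windows.)
* A resetting step erases the memory, keeps input and output bit, and increments the counter. -/
noncomputable def stepDist (c : Config n Mem Msg) : Step n → PMF (Config n Mem Msg)
  | .send i =>
      if (c.state i).sent then PMF.pure c
      else PMF.pure
        { state := Function.update c.state i { c.state i with sent := true }
          buffer := Function.update c.buffer i fun j => some (A.message i (c.state i) j) }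
  | .receive i j =>
      match c.buffer j i with
      | none => PMF.pure c
      | some m => (A.receive i (c.state i) j m).map fun r =>
        { state := Function.update c.state i
            { c.state i with
              mem := r.1
              output := (c.state i).output.or r.2
              sent := false }
          buffer := Function.update c.buffer j (Function.update (c.buffer j) i none) }
  | .reset i => PMF.pure
      { c with
        state := Function.update c.state i
          { c.state i with
            mem := A.blank
            resets := (c.state i).resets + 1
            sent := false } }

/-- The probability of a partial execution: the product of the probabilities of its transitions. -/
noncomputable def prob : Exec n Mem Msg → ℝ≥0∞
  | .start _ => 1
  | .snoc e s c => prob e * A.stepDist (A.last e) s c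

/-- A configuration is reachable if it results from a partial execution of non-zero probability
that is a concatenation of acceptable windows. -/
def Reachable (t : ℕ) (c : Config n Mem Msg) : Prop :=
  ∃ e : Exec n Mem Msg, A.prob e ≠ 0 ∧ (∃ m, IsWindowSeq t m e.schedule) ∧ A.last e = c

/-- Measure one correctness: in every reachable configuration all output bits that are written
agree, and they agree with one of the input bits. -/
def MeasureOneCorrectness (t : ℕ) : Prop :=
  ∀ c : Config n Mem Msg, A.Reachable t c →
    (∀ i j a b, (c.state i).output = some a → (c.state j).output = some b → a = b) ∧
    (∀ i b, (c.state i).output = some b → ∃ j, (c.state j).input = b)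

/-- `e` is an infinite execution (given by its finite initial parts) that the adversary `adv`
can produce. -/
def IsInfiniteExec (adv : Adversary n Mem Msg) (e : ℕ → Exec n Mem Msg) : Prop :=
  (∃ inputs, e 0 = .start inputs) ∧
  ∀ N, ∃ c, A.stepDist (A.last (e N)) (adv (e N)) c ≠ 0 ∧ e (N + 1) = .snoc (e N) (adv (e N)) c

/-- A strongly adaptive adversary: every infinite execution it can produce is composed entirely of
adjacent, disjoint acceptable windows `w 0, w 1, w 2, …`. -/
def IsStronglyAdaptive (t : ℕ) (adv : Adversary n Mem Msg) : Prop :=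
  ∀ e : ℕ → Exec n Mem Msg, A.IsInfiniteExec adv e →
    ∃ w : ℕ → List (Step n), (∀ k, IsAcceptableWindow t (w k)) ∧
      ∀ k, ∃ N, (e N).schedule = ((List.range k).map w).flatten

/-- The distribution of the partial execution consisting of the first `N` steps, when the adversary
`adv` controls the steps and the input bits are `inputs`. -/
noncomputable def run (adv : Adversary n Mem Msg) (inputs : Fin n → Bool) :
    ℕ → PMF (Exec n Mem Msg)
  | 0 => PMF.pure (.start inputs)
  | N + 1 => (run adv inputs N).bind fun e =>
      (A.stepDist (A.last e) (adv e)).map fun c => .snoc e (adv e) c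

/-- Measure one termination: against every strongly adaptive adversary and for all inputs, for each
processor `i` the probability that `i` never decides is zero. Here the probability that `i` never
decides is the limit of the (decreasing) probabilities that `i` has not decided within `N` steps.
(When `t < n`, every processor takes a sending and a receiving step in each acceptable window.) -/
def MeasureOneTermination (t : ℕ) : Prop :=
  ∀ adv : Adversary n Mem Msg, A.IsStronglyAdaptive t adv → ∀ (inputs : Fin n → Bool) (i : Fin n),
    Filter.Tendsto
      (fun N => (A.run adv inputs N).toOuterMeasure
        {e | ((A.last e).state i).output = none})
      Filter.atTop (𝓝 0)

/-- In the partial execution `e`, at least `m` acceptable windows pass before the first processor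
decides: an initial part of `e` consists of `m` acceptable windows, and no output bit is written at
its end. -/
def RunsUndecidedFor (t m : ℕ) (e : Exec n Mem Msg) : Prop :=
  ∃ p : Exec n Mem Msg, p.IsPrefix e ∧ IsWindowSeq t m p.schedule ∧ (A.last p).Undecided

/-- The probability that the running time (the number of acceptable windows that pass before the
first processor decides) is at least `x`, as the limit of the increasing probabilities that this is
witnessed within the first `N` steps. -/
noncomputable def probRunningTimeAtLeast (t : ℕ) (adv : Adversary n Mem Msg)
    (inputs : Fin n → Bool) (x : ℝ) : ℝ≥0∞ :=
  ⨆ N, (A.run adv inputs N).toOuterMeasure {e | ∃ m : ℕ, x ≤ m ∧ A.RunsUndecidedFor t m e}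

end Algorithm

end AsyncAgreement

/-!
An adversary cannot be prevented from keeping the system in states from which neither decision is
hard to avoid. The idea is to follow, for each value `b`, the set `Valent b k` of the reachable
states from which the adversary cannot reliably avoid the decision `b` for `k` windows. It is
defined by recursion: at level `0` some processor has decided `b`; at level `k + 1`, whoever hears
from whom in the next window, with more than a threshold probability the outcome is such that no
choice of at most `t` resets leads out of level `k`.

The main invariant (`Separated`) is that states which are valent for different values differ at more
than `t` processors.

* At level `0` (`separated_zero`), suppose that two such states agree outside a set `T` of at most
  `t` processors, and silence `T` forever. By termination somebody outside `T` may decide, and the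
  same run is possible from both states, so one of the two would violate correctness.
* For the step from `k` to `k + 1` (`Separated.not_both`), silence `T` for one window. The new states
  of the processors outside `T` have the same product distribution from both starting points.
  By concentration of product measures (`resample_mul_le_of_far`), two sets of outcomes that are both
  more likely than `exp (-t ^ 2 / (4 * n))` contain outcomes `X` and `Y` that differ, outside `T`, on
  a set `D` of fewer than `t` processors. Resetting `D` makes them agree outside `T`, as a reset
  erases everything but the input, the counter and the output. The outputs agree because a processor
  outside `T` that has decided in `X` could also have decided in `Y`, changing a single coordinate
  (`Separated.output_eq_none`).

Given the invariant, interpolation by changing one processor at a time produces inputs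
(`Separated.exists_inputs`), sets of senders (`Separated.exists_hear`) and resets
(`Separated.exists_reset`) for which neither value is hard to avoid. For the sets of senders,
`Separated.not_both` applies again: two windows that differ only in whom processor `i` hears have
transition distributions that agree outside `{i}`. Each window fails with at most twice the threshold
probability. In the last window the threshold is `0`, so that it never fails; this gives the bound
also when `n` is so small that the exponential estimate is vacuous.

The concentration inequality rests on the bound `E[g] * E[1 / g] ≤ cosh lam ^ n` for a function `g`
that changes by a factor of at most `exp lam` when one of `n` independent coordinates changes, which
tensorizes (`expect_resample_mul_expect_inv_le`); it is applied to `g = exp (lam * distance)`.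
-/

/-! ### Expectations with respect to discrete distributions -/

namespace AsyncAgreement

/-- The expectation of a nonnegative function under a discrete probability distribution. -/
noncomputable def expect {α : Type*} (p : PMF α) (f : α → ℝ≥0∞) : ℝ≥0∞ := ∑' a, p a * f a

section Expect

variable {α β : Type*}

theorem expect_pure (a : α) (f : α → ℝ≥0∞) : expect (PMF.pure a) f = f a := by
  classical
  unfold expect
  rw [tsum_eq_single a]
  · simp
  · intro b hb; simp [hb]

theorem expect_bind (p : PMF α) (q : α → PMF β) (f : β → ℝ≥0∞) :
    expect (p.bind q) f = expect p fun a => expect (q a) f := by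
  unfold expect
  simp only [PMF.bind_apply, ← ENNReal.tsum_mul_right, ← ENNReal.tsum_mul_left]
  rw [ENNReal.tsum_comm]
  simp only [mul_assoc]

theorem expect_map (p : PMF α) (g : α → β) (f : β → ℝ≥0∞) :
    expect (p.map g) f = expect p fun a => f (g a) := by
  rw [← PMF.bind_pure_comp, expect_bind]
  simp [expect_pure]

theorem expect_mono {p : PMF α} {f g : α → ℝ≥0∞} (h : ∀ a ∈ p.support, f a ≤ g a) :
    expect p f ≤ expect p g := by
  refine ENNReal.tsum_le_tsum fun a => ?_
  by_cases ha : p a = 0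
  · simp [ha]
  · exact mul_le_mul_right (h a ((PMF.mem_support_iff p a).2 ha)) _

theorem expect_const (p : PMF α) (c : ℝ≥0∞) : expect p (fun _ => c) = c := by
  simp [expect, ENNReal.tsum_mul_right, p.tsum_coe]

theorem expect_add (p : PMF α) (f g : α → ℝ≥0∞) :
    expect p (fun a => f a + g a) = expect p f + expect p g := by
  simp [expect, mul_add, ENNReal.tsum_add]

theorem expect_const_mul (p : PMF α) (c : ℝ≥0∞) (f : α → ℝ≥0∞) :
    expect p (fun a => c * f a) = c * expect p f := by
  simp only [expect, ← ENNReal.tsum_mul_left, mul_left_comm]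

theorem expect_mul_const (p : PMF α) (c : ℝ≥0∞) (f : α → ℝ≥0∞) :
    expect p (fun a => f a * c) = expect p f * c := by
  simp only [mul_comm _ c, expect_const_mul]

theorem toOuterMeasure_eq_expect (p : PMF α) (s : Set α) :
    p.toOuterMeasure s = expect p (s.indicator fun _ => 1) := by
  rw [PMF.toOuterMeasure_apply]
  refine tsum_congr fun a => ?_
  by_cases ha : a ∈ s <;> simp [ha]

theorem exists_mem_of_toOuterMeasure_ne_zero {p : PMF α} {s : Set α}
    (h : p.toOuterMeasure s ≠ 0) : ∃ a ∈ p.support, a ∈ s := by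
  by_contra! hc
  exact h ((PMF.toOuterMeasure_apply_eq_zero_iff p s).2
    (Set.disjoint_left.2 hc))

theorem apply_mul_le_expect (p : PMF α) (a : α) (f : α → ℝ≥0∞) : p a * f a ≤ expect p f :=
  ENNReal.le_tsum a

end Expect

/-! ### Products of discrete distributions and concentration -/

section Product

variable {ι Ω : Type*} [DecidableEq ι]

/-- Starting from the vector `s`, the coordinates in the list `l` are resampled independently, the
coordinate `i` according to `μ i`. -/
noncomputable def resample (μ : ι → PMF Ω) : List ι → (ι → Ω) → PMF (ι → Ω)
  | [], s => PMF.pure s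
  | i :: l, s => (μ i).bind fun x => resample μ l (Function.update s i x)

theorem mem_support_resample {μ : ι → PMF Ω} {l : List ι} (hl : l.Nodup) {s x : ι → Ω} :
    x ∈ (resample μ l s).support ↔ (∀ i ∈ l, x i ∈ (μ i).support) ∧ ∀ i ∉ l, x i = s i := by
  induction l generalizing s with
  | nil => simp [resample, funext_iff]
  | cons j l ih =>
    obtain ⟨hj, hl⟩ := List.nodup_cons.1 hl
    simp only [resample, PMF.mem_support_bind_iff, ih hl]
    constructor
    · rintro ⟨y, hy, h1, h2⟩
      have hxj : x j = y := by simpa using h2 j hj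
      refine ⟨fun i hi => ?_, fun i hi => ?_⟩
      · rcases List.mem_cons.1 hi with rfl | hi
        · rwa [hxj]
        · exact h1 i hi
      · simp only [List.mem_cons, not_or] at hi
        simpa [hi.1] using h2 i hi.2
    · rintro ⟨h1, h2⟩
      refine ⟨x j, h1 j (by simp), fun i hi => h1 i (by simp [hi]), fun i hi => ?_⟩
      by_cases hij : i = j
      · subst hij; simp
      · simpa [hij] using h2 i (by simp [hij, hi])

theorem resample_congr {μ ν : ι → PMF Ω} {l : List ι} (h : ∀ i ∈ l, μ i = ν i) (s : ι → Ω) :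
    resample μ l s = resample ν l s := by
  induction l generalizing s with
  | nil => rfl
  | cons j l ih =>
    simp only [resample, h j (by simp)]
    congr 1
    funext x
    exact ih (fun i hi => h i (by simp [hi])) _

theorem expect_resample_update_le {μ : ι → PMF Ω} {a : ℝ≥0∞} (ha : 1 ≤ a)
    {g : (ι → Ω) → ℝ≥0∞} (hg : ∀ s i x, g (Function.update s i x) ≤ a * g s) (l : List ι)
    (s : ι → Ω) (i : ι) (x : Ω) :
    expect (resample μ l (Function.update s i x)) g ≤ a * expect (resample μ l s) g := by
  induction l generalizing s with
  | nil => simpa [resample, expect_pure] using hg s i x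
  | cons j l ih =>
    simp only [resample, expect_bind, ← expect_const_mul]
    refine expect_mono fun y _ => ?_
    rw [expect_const_mul]
    by_cases hij : i = j
    · subst hij
      rw [Function.update_idem]
      exact le_mul_of_one_le_left' ha
    · rw [Function.update_comm hij]
      exact ih _

theorem add_inv_le_add_inv {a r : ℝ≥0∞} (ha : a ≠ ∞) (h1 : r ≤ a) (h2 : a⁻¹ ≤ r) (h0 : a ≠ 0) :
    r + r⁻¹ ≤ a + a⁻¹ := by
  have hr : r ≠ ∞ := ne_top_of_le_ne_top ha h1
  have hr0 : r ≠ 0 := by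
    rintro rfl
    simp [ha] at h2
  lift a to NNReal using ha
  lift r to NNReal using hr
  have h0' : a ≠ 0 := by exact_mod_cast h0
  have hr0' : r ≠ 0 := by exact_mod_cast hr0
  rw [← ENNReal.coe_inv h0'] at *
  rw [← ENNReal.coe_inv hr0'] at *
  norm_cast at *
  have p1 : (0 : ℝ) < a := by positivity
  have p2 : (0 : ℝ) < r := by positivity
  have h1' : (r : ℝ) ≤ a := by exact_mod_cast h1
  have h2' : (a : ℝ)⁻¹ ≤ r := by exact_mod_cast h2
  have h3 : (1 : ℝ) ≤ r * a := by
    rw [inv_le_iff_one_le_mul₀ p1] at h2'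
    exact h2'
  rw [← NNReal.coe_le_coe]
  push_cast
  have key : (a : ℝ) + (a : ℝ)⁻¹ - (r + (r : ℝ)⁻¹) = (a - r) * (r * a - 1) / (r * a) := by
    field_simp
    ring
  have : 0 ≤ ((a : ℝ) - r) * (r * a - 1) / (r * a) := by
    apply div_nonneg (mul_nonneg _ _) (by positivity) <;> linarith
  linarith

/-- A function whose values differ by factors of at most `a` satisfies
`E[G] * E[1/G] ≤ (a + 1/a) / 2`: symmetrize the double sum of `G x / G y`. -/
theorem expect_mul_expect_inv_le_of_ratio (p : PMF Ω) {a : ℝ≥0∞} (ha : 1 ≤ a) (hat : a ≠ ∞)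
    {G : Ω → ℝ≥0∞} (hG0 : ∀ x, G x ≠ 0) (hGt : ∀ x, G x ≠ ∞) (hG : ∀ x y, G x ≤ a * G y) :
    expect p G * expect p (fun x => (G x)⁻¹) ≤ (a + a⁻¹) / 2 := by
  have h0 : a ≠ 0 := (zero_lt_one.trans_le ha).ne'
  have e1 : expect p G * expect p (fun x => (G x)⁻¹)
      = expect p fun x => expect p fun y => G x * (G y)⁻¹ := by
    simp only [expect_const_mul, expect_mul_const]
  have e2 : expect p G * expect p (fun x => (G x)⁻¹)
      = expect p fun x => expect p fun y => (G x * (G y)⁻¹)⁻¹ := by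
    rw [mul_comm]
    have : ∀ x y, (G x * (G y)⁻¹)⁻¹ = (G x)⁻¹ * G y := fun x y => by
      rw [ENNReal.mul_inv (Or.inl (hG0 x)) (Or.inl (hGt x)), inv_inv]
    simp only [this, expect_const_mul, expect_mul_const]
  rw [ENNReal.le_div_iff_mul_le (by simp) (by simp), mul_two]
  nth_rewrite 1 [e1]
  rw [e2, ← expect_add]
  calc _ ≤ expect p fun _ => a + a⁻¹ := by
        refine expect_mono fun x _ => ?_
        rw [← expect_add]
        refine (expect_mono fun y _ => ?_).trans_eq (expect_const p (a + a⁻¹))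
        refine add_inv_le_add_inv hat ?_ ?_ h0
        · rw [← div_eq_mul_inv]
          exact ENNReal.div_le_of_le_mul (hG x y)
        · rw [← div_eq_mul_inv, ENNReal.le_div_iff_mul_le (Or.inl (hG0 y)) (Or.inl (hGt y)),
            mul_comm, ← div_eq_mul_inv]
          exact ENNReal.div_le_of_le_mul' (hG y x)
    _ = _ := expect_const _ _

/-- Tensorization of `expect_mul_expect_inv_le_of_ratio`: coordinates outside `T` contribute one
factor each, and coordinates in `T`, on which `g` does not depend and where the two product
distributions may differ, contribute nothing. -/
theorem expect_resample_mul_expect_inv_le {T : Finset ι} {μ ν : ι → PMF Ω}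
    (hμν : ∀ i ∉ T, μ i = ν i) {a lo hi : ℝ≥0∞} (ha : 1 ≤ a) (hat : a ≠ ∞) (hlo : lo ≠ 0)
    (hhi : hi ≠ ∞) {g : (ι → Ω) → ℝ≥0∞} (hglo : ∀ s, lo ≤ g s) (hghi : ∀ s, g s ≤ hi)
    (hgT : ∀ s s', (∀ i ∉ T, s i = s' i) → g s = g s')
    (hg : ∀ s i x, g (Function.update s i x) ≤ a * g s) (l : List ι) (s s' : ι → Ω)
    (hs : ∀ i ∉ T, s i = s' i) :
    expect (resample μ l s) g * expect (resample ν l s') (fun x => (g x)⁻¹)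
      ≤ ((a + a⁻¹) / 2) ^ l.length := by
  have hK : 1 ≤ (a + a⁻¹) / 2 := by
    rw [ENNReal.le_div_iff_mul_le (by simp) (by simp), one_mul]
    have := add_inv_le_add_inv (r := 1) hat ha (by simpa using ha)
      (zero_lt_one.trans_le ha).ne'
    rwa [inv_one, one_add_one_eq_two] at this
  induction l generalizing s s' with
  | nil =>
    simp only [resample, expect_pure, List.length_nil, pow_zero]
    rw [hgT s s' hs, ENNReal.mul_inv_cancel]
    · exact fun h => hlo (le_zero_iff.1 (h ▸ hglo s'))
    · exact ne_top_of_le_ne_top hhi (hghi s')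
  | cons i l ih =>
    simp only [resample, expect_bind, List.length_cons]
    set G := fun x => expect (resample μ l (Function.update s i x)) g with hGdef
    set H := fun y => expect (resample ν l (Function.update s' i y)) (fun x => (g x)⁻¹) with hHdef
    by_cases hi' : i ∈ T
    · have key : ∀ x y, G x * H y ≤ ((a + a⁻¹) / 2) ^ l.length := fun x y => by
        refine ih _ _ fun j hj => ?_
        have : j ≠ i := fun h => hj (h ▸ hi')
        simpa [this] using hs j hj
      calc expect (μ i) G * expect (ν i) H
          = expect (μ i) fun x => expect (ν i) fun y => G x * H y := by
            simp only [expect_const_mul, expect_mul_const]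
        _ ≤ expect (μ i) fun _ => expect (ν i) fun _ => ((a + a⁻¹) / 2) ^ l.length :=
            expect_mono fun x _ => expect_mono fun y _ => key x y
        _ = ((a + a⁻¹) / 2) ^ l.length := by simp only [expect_const]
        _ ≤ _ := pow_le_pow_right' hK (Nat.le_succ _)
    · have hG0 : ∀ x, G x ≠ 0 := fun x h => hlo <| le_zero_iff.1 <| by
        rw [← h, hGdef, ← expect_const (resample μ l (Function.update s i x)) lo]
        exact expect_mono fun y _ => hglo y
      have hGt : ∀ x, G x ≠ ∞ := fun x => ne_top_of_le_ne_top hhi <| by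
        rw [hGdef, ← expect_const (resample μ l (Function.update s i x)) hi]
        exact expect_mono fun y _ => hghi y
      have hGr : ∀ x y, G x ≤ a * G y := fun x y => by
        have := expect_resample_update_le (μ := μ) ha hg l (Function.update s i y) i x
        rwa [Function.update_idem] at this
      have hH : ∀ y, H y ≤ ((a + a⁻¹) / 2) ^ l.length * (G y)⁻¹ := fun y => by
        rw [← div_eq_mul_inv, ENNReal.le_div_iff_mul_le (Or.inl (hG0 y)) (Or.inl (hGt y)), mul_comm]
        refine ih _ _ fun j hj => ?_
        by_cases hji : j = i
        · subst hji; simp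
        · simpa [hji] using hs j hj
      rw [← hμν i hi']
      calc expect (μ i) G * expect (μ i) H
          ≤ expect (μ i) G * (((a + a⁻¹) / 2) ^ l.length * expect (μ i) fun y => (G y)⁻¹) := by
            rw [← expect_const_mul (μ i) _ fun y => (G y)⁻¹]
            exact mul_le_mul_right (expect_mono fun y _ => hH y) _
        _ = ((a + a⁻¹) / 2) ^ l.length * (expect (μ i) G * expect (μ i) fun y => (G y)⁻¹) :=
            mul_left_comm _ _ _
        _ ≤ ((a + a⁻¹) / 2) ^ l.length * ((a + a⁻¹) / 2) :=
            mul_le_mul_right (expect_mul_expect_inv_le_of_ratio (μ i) ha hat hG0 hGt hGr) _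
        _ = _ := (pow_succ _ _).symm

open Classical in
/-- The set of coordinates outside `T` at which two vectors differ. -/
noncomputable def diffOutside [Fintype ι] (T : Finset ι) (x y : ι → Ω) : Finset ι :=
  {i | i ∉ T ∧ x i ≠ y i}

theorem mem_diffOutside [Fintype ι] {T : Finset ι} {x y : ι → Ω} {i : ι} :
    i ∈ diffOutside T x y ↔ i ∉ T ∧ x i ≠ y i := by
  simp [diffOutside]

/-- Two sets that differ in at least `d` coordinates outside `T` cannot both be likely, even if
their probabilities are taken under product distributions that differ on the coordinates in `T`. -/
theorem resample_mul_le_of_far [Fintype ι] {T : Finset ι} {μ ν : ι → PMF Ω}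
    (hμν : ∀ i ∉ T, μ i = ν i) (l : List ι) (s s' : ι → Ω) (hs : ∀ i ∉ T, s i = s' i)
    (E F : Set (ι → Ω)) (d : ℕ) (hd : ∀ x ∈ E, ∀ y ∈ F, d ≤ (diffOutside T y x).card) :
    (resample μ l s).toOuterMeasure E * (resample ν l s').toOuterMeasure F
      ≤ ENNReal.ofReal (Real.exp (-(d ^ 2 / (2 * l.length)))) := by
  rcases E.eq_empty_or_nonempty with rfl | hE
  · simp
  rcases l.eq_nil_or_concat with hnil | ⟨_, _, hne⟩
  · -- without resampled coordinates the exponent is `d ^ 2 / 0 = 0`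
    subst hnil
    simp only [List.length_nil, Nat.cast_zero, mul_zero, div_zero, neg_zero, Real.exp_zero,
      ENNReal.ofReal_one]
    refine mul_le_one' ?_ ?_ <;>
    · rw [toOuterMeasure_eq_expect]
      refine (expect_mono (g := fun _ => 1) fun x _ => ?_).trans_eq (expect_const _ _)
      exact Set.indicator_le_self' (by simp) x
  have hlen : (0 : ℝ) < l.length := by rw [hne]; simp; positivity
  clear hne
  -- the distance to `E`, outside `T`
  let f : (ι → Ω) → ℕ := fun x => sInf ((fun z => (diffOutside T x z).card) '' E)
  have hf_le : ∀ x, ∀ z ∈ E, f x ≤ (diffOutside T x z).card := fun x z hz =>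
    Nat.sInf_le ⟨z, hz, rfl⟩
  have hf_ex : ∀ x, ∃ z ∈ E, (diffOutside T x z).card = f x := fun x =>
    Nat.sInf_mem (hE.image _)
  have hfE : ∀ x ∈ E, f x = 0 := fun x hx => by
    have := hf_le x x hx
    have h0 : diffOutside T x x = ∅ := by
      ext i; simp [mem_diffOutside]
    simpa [h0] using this
  have hfF : ∀ y ∈ F, d ≤ f y := fun y hy => by
    obtain ⟨z, hz, h⟩ := hf_ex y
    exact h ▸ hd z hz y hy
  have hfT : ∀ x x', (∀ i ∉ T, x i = x' i) → f x = f x' := fun x x' h => by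
    have : ∀ z, diffOutside T x z = diffOutside T x' z := fun z => by
      ext i
      simp only [mem_diffOutside]
      exact and_congr_right fun hi => by rw [h i hi]
    simp only [f, this]
  have hf_upd : ∀ x i a, f (Function.update x i a) ≤ f x + 1 := fun x i a => by
    obtain ⟨z, hz, h⟩ := hf_ex x
    refine (hf_le _ z hz).trans ?_
    rw [← h]
    refine (Finset.card_le_card (t := insert i (diffOutside T x z)) fun j hj => ?_).trans
      (Finset.card_insert_le _ _)
    rw [Finset.mem_insert]
    by_cases hji : j = i
    · exact Or.inl hji
    · right
      rw [mem_diffOutside] at hj ⊢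
      simpa [hji] using hj
  have hf_card : ∀ x, f x ≤ Fintype.card ι := fun x => by
    obtain ⟨z, hz, h⟩ := hf_ex x
    exact h ▸ Finset.card_le_univ _
  -- the optimal parameter of the exponential moment
  set lam : ℝ := d / l.length with hlam
  have hlam0 : 0 ≤ lam := by positivity
  let g : (ι → Ω) → ℝ≥0∞ := fun x => ENNReal.ofReal (Real.exp (lam * f x))
  have ha : 1 ≤ ENNReal.ofReal (Real.exp lam) := by
    rw [ENNReal.one_le_ofReal]; exact Real.one_le_exp hlam0
  have main := expect_resample_mul_expect_inv_le (μ := ν) (ν := μ) (T := T)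
    (fun i hi => (hμν i hi).symm) (a := ENNReal.ofReal (Real.exp lam)) (lo := 1)
    (hi := ENNReal.ofReal (Real.exp (lam * Fintype.card ι))) ha ENNReal.ofReal_ne_top one_ne_zero
    ENNReal.ofReal_ne_top (g := g)
    (fun x => by
      rw [ENNReal.one_le_ofReal]; exact Real.one_le_exp (by positivity))
    (fun x => by
      refine ENNReal.ofReal_le_ofReal (Real.exp_le_exp.2 (mul_le_mul_of_nonneg_left ?_ hlam0))
      exact_mod_cast hf_card x)
    (fun x x' h => by simp only [g, hfT x x' h])
    (fun x i a => by
      simp only [g]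
      rw [← ENNReal.ofReal_mul (Real.exp_nonneg _), ← Real.exp_add]
      refine ENNReal.ofReal_le_ofReal (Real.exp_le_exp.2 ?_)
      have : (f (Function.update x i a) : ℝ) ≤ f x + 1 := by exact_mod_cast hf_upd x i a
      nlinarith)
    l s' s (fun i hi => (hs i hi).symm)
  have hPE : (resample μ l s).toOuterMeasure E
      ≤ expect (resample μ l s) fun x => (g x)⁻¹ := by
    rw [toOuterMeasure_eq_expect]
    refine expect_mono fun x _ => ?_
    by_cases hx : x ∈ E
    · simp [g, hfE x hx, hx]
    · simp [hx]
  have hPF : ENNReal.ofReal (Real.exp (lam * d)) * (resample ν l s').toOuterMeasure F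
      ≤ expect (resample ν l s') g := by
    rw [toOuterMeasure_eq_expect, ← expect_const_mul]
    refine expect_mono fun x _ => ?_
    by_cases hx : x ∈ F
    · simp only [hx, Set.indicator_of_mem, mul_one, g]
      refine ENNReal.ofReal_le_ofReal (Real.exp_le_exp.2 (mul_le_mul_of_nonneg_left ?_ hlam0))
      exact_mod_cast hfF x hx
    · simp [hx]
  have hcosh : (ENNReal.ofReal (Real.exp lam) + (ENNReal.ofReal (Real.exp lam))⁻¹) / 2
      ≤ ENNReal.ofReal (Real.exp (lam ^ 2 / 2)) := by
    rw [← ENNReal.ofReal_inv_of_pos (Real.exp_pos _), ← Real.exp_neg,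
      ← ENNReal.ofReal_add (Real.exp_nonneg _) (Real.exp_nonneg _),
      ← ENNReal.ofReal_ofNat, ← ENNReal.ofReal_div_of_pos (by norm_num), ← Real.cosh_eq]
    exact ENNReal.ofReal_le_ofReal (Real.cosh_le_exp_half_sq lam)
  have hfin : ENNReal.ofReal (Real.exp (lam * d)) *
      ((resample μ l s).toOuterMeasure E * (resample ν l s').toOuterMeasure F)
      ≤ ENNReal.ofReal (Real.exp (lam ^ 2 / 2)) ^ l.length := by
    calc _ = (ENNReal.ofReal (Real.exp (lam * d)) * (resample ν l s').toOuterMeasure F) *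
          (resample μ l s).toOuterMeasure E := by ring
      _ ≤ _ := mul_le_mul' hPF hPE
      _ ≤ _ := main
      _ ≤ _ := pow_le_pow_left' hcosh _
  rw [mul_comm, ← ENNReal.le_div_iff_mul_le (Or.inl (by simp [Real.exp_pos]))
    (Or.inl ENNReal.ofReal_ne_top)] at hfin
  refine hfin.trans_eq ?_
  rw [← ENNReal.ofReal_pow (Real.exp_nonneg _), ← ENNReal.ofReal_div_of_pos (Real.exp_pos _),
    ← Real.exp_nat_mul, ← Real.exp_sub]
  congr 2
  rw [hlam]
  field_simp
  ring

end Product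

variable {n : ℕ} {Mem Msg : Type*}

/-! ### Windows and moves -/

/-- The sending and receiving steps of the window in which each `i` hears from `S i`. -/
noncomputable def sendReceive (S : Fin n → Finset (Fin n)) : List (Step n) :=
  (List.finRange n).map Step.send ++
    (List.finRange n).flatMap fun i => (S i).toList.map (Step.receive i)

/-- What the adversary decides on between two sequences of receiving steps: whom to reset at the end
of the current window, and from whom each processor hears in the next window. -/
structure Move (n : ℕ) where
  reset : Finset (Fin n)
  hear : Fin n → Finset (Fin n)

/-- The steps by which a move is carried out. -/
noncomputable def Move.steps (v : Move n) : List (Step n) :=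
  v.reset.toList.map Step.reset ++ sendReceive v.hear

/-- A move is legal if it resets at most `t` processors, and each processor hears from at least
`n - t` processors. -/
def Move.Legal (t : ℕ) (v : Move n) : Prop :=
  v.reset.card ≤ t ∧ ∀ i, n ≤ (v.hear i).card + t

theorem Move.steps_ne_nil [NeZero n] (v : Move n) : v.steps ≠ [] := by
  simp [Move.steps, sendReceive, NeZero.ne n]

theorem Move.length_steps_le {t : ℕ} {v : Move n} (hv : v.Legal t) :
    v.steps.length ≤ t + (n + n * n) := by
  have h : ((List.finRange n).flatMap fun i => (v.hear i).toList.map (Step.receive i)).length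
      ≤ n * n := by
    rw [List.length_flatMap]
    refine (List.sum_le_card_nsmul _ n fun x hx => ?_).trans_eq (by simp)
    obtain ⟨i, -, rfl⟩ := List.mem_map.1 hx
    simpa using Finset.card_le_univ (v.hear i)
  simp only [Move.steps, sendReceive, List.length_append, List.length_map, List.length_finRange,
    Finset.length_toList]
  exact Nat.add_le_add hv.1 (Nat.add_le_add_left h n)

theorem isAcceptableWindow_sendReceive {t : ℕ} {S : Fin n → Finset (Fin n)} {R : Finset (Fin n)}
    (hS : ∀ i, n ≤ (S i).card + t) (hR : R.card ≤ t) :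
    IsAcceptableWindow t (sendReceive S ++ R.toList.map Step.reset) := by
  refine ⟨List.finRange n, S, (List.finRange n).flatMap fun i => (S i).toList.map (Prod.mk i),
    R.toList, List.nodup_finRange n, List.mem_finRange, hS, ?_, ?_, by simpa using hR, ?_⟩
  · rw [List.nodup_flatMap]
    refine ⟨fun i _ => (Finset.nodup_toList _).map (Prod.mk_right_injective i), ?_⟩
    refine (List.nodup_finRange n).imp fun {i j} hij => ?_
    simp only [Function.onFun, List.disjoint_left, List.mem_map]
    rintro _ ⟨a, _, rfl⟩ ⟨b, _, h⟩
    exact hij (congrArg Prod.fst h).symm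
  · intro i j
    simp
  · simp [sendReceive, List.map_flatMap, Function.comp_def]

/-- A strategy prescribes a move, given the number of moves carried out so far and the states that
they have led to. -/
abbrev Strategy (n : ℕ) (Mem : Type*) := ℕ → (Fin n → ProcState Mem) → Move n

/-- All moves are legal, and the first one resets nobody (as no window has begun). -/
def Strategy.Legal (t : ℕ) (σ : Strategy n Mem) : Prop :=
  (∀ k X, (σ k X).Legal t) ∧ ∀ X, (σ 0 X).reset = ∅

theorem Exec.IsPrefix.of_snoc {p e : Exec n Mem Msg} {s : Step n}
    {c : Config n Mem Msg} (h : Exec.IsPrefix (.snoc p s c) e) : p.IsPrefix e := by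
  generalize hq : Exec.snoc p s c = q at h
  induction h with
  | refl => subst hq; exact .snoc s c (.refl p)
  | snoc s' c' _ ih => exact .snoc s' c' ih

/-! ### The effect of one window on the processor states -/

namespace Algorithm

variable (A : Algorithm n Mem Msg)

/-- The distribution of the configuration after a list of steps. -/
noncomputable def runSteps : List (Step n) → Config n Mem Msg → PMF (Config n Mem Msg)
  | [], c => PMF.pure c
  | s :: l, c => (A.stepDist c s).bind (runSteps l)

theorem runSteps_append (l l' : List (Step n)) (c : Config n Mem Msg) :
    A.runSteps (l ++ l') c = (A.runSteps l c).bind (A.runSteps l') := by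
  induction l generalizing c with
  | nil => simp [runSteps]
  | cons s l ih =>
    simp only [List.cons_append, runSteps, PMF.bind_bind]
    congr 1
    funext c
    exact ih c

/-- The distribution of the state of processor `i` after it receives `msg j` from each `j` in the
given list, in this order. -/
noncomputable def procRun (i : Fin n) (msg : Fin n → Msg) :
    List (Fin n) → ProcState Mem → PMF (ProcState Mem)
  | [], p => PMF.pure p
  | j :: js, p => (A.receive i p j (msg j)).bind fun r =>
      procRun i msg js { p with mem := r.1, output := p.output.or r.2, sent := false }

theorem procRun_invariants {i : Fin n} {msg : Fin n → Msg} {js : List (Fin n)}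
    {p q : ProcState Mem} (h : q ∈ (A.procRun i msg js p).support) :
    q.input = p.input ∧ q.resets = p.resets ∧ (∀ b, p.output = some b → q.output = some b) ∧
      (js ≠ [] ∨ p.sent = false → q.sent = false) := by
  induction js generalizing p with
  | nil =>
    simp only [procRun, PMF.support_pure, Set.mem_singleton_iff] at h
    subst h
    simp
  | cons j js ih =>
    simp only [procRun, PMF.mem_support_bind_iff] at h
    obtain ⟨r, -, hr⟩ := h
    obtain ⟨h1, h2, h3, h4⟩ := ih hr
    exact ⟨h1, h2, fun b hb => h3 b (by simp [hb]), fun _ => h4 (Or.inr rfl)⟩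

theorem runSteps_receive (i : Fin n) (msg : Fin n → Msg) (js : List (Fin n)) (hjs : js.Nodup)
    (c : Config n Mem Msg) (hc : ∀ j ∈ js, c.buffer j i = some (msg j)) :
    A.runSteps (js.map (Step.receive i)) c = (A.procRun i msg js (c.state i)).map fun p =>
      { state := Function.update c.state i p
        buffer := fun j k => if k = i ∧ j ∈ js then none else c.buffer j k } := by
  induction js generalizing c with
  | nil =>
    simp [runSteps, procRun, PMF.pure_map]
  | cons j js ih =>
    obtain ⟨hj, hjs⟩ := List.nodup_cons.1 hjs
    have h0 : c.buffer j i = some (msg j) := hc j (by simp)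
    simp only [List.map_cons, runSteps, stepDist, h0, procRun, PMF.map_bind, PMF.bind_map]
    congr 1
    funext r
    simp only [Function.comp]
    rw [ih hjs]
    · simp only [Function.update_self, Function.update_idem]
      congr 1
      funext p
      congr 1
      funext j' k
      by_cases hk : k = i
      · subst hk
        by_cases hj' : j' = j
        · subst hj'; simp
        · simp [hj']
      · by_cases hj' : j' = j
        · subst hj'; simp [hk]
        · simp [hj', hk]
    · intro j' hj'
      have : j' ≠ j := fun h => hj (h ▸ hj')
      simpa [this] using hc j' (by simp [hj'])

theorem map_state_runSteps_receive (msg : Fin n → Fin n → Msg) (js : Fin n → List (Fin n))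
    (hjs : ∀ i, (js i).Nodup) (l : List (Fin n)) (hl : l.Nodup) (c : Config n Mem Msg)
    (hc : ∀ i ∈ l, ∀ j ∈ js i, c.buffer j i = some (msg i j)) :
    (A.runSteps (l.flatMap fun i => (js i).map (Step.receive i)) c).map Config.state
      = resample (fun i => A.procRun i (msg i) (js i) (c.state i)) l c.state := by
  induction l generalizing c with
  | nil => simp [runSteps, resample, PMF.pure_map]
  | cons i l ih =>
    obtain ⟨hi, hl⟩ := List.nodup_cons.1 hl
    rw [List.flatMap_cons, runSteps_append,
      A.runSteps_receive i (msg i) _ (hjs i) c (hc i (by simp)), PMF.map_bind, PMF.bind_map]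
    simp only [resample]
    congr 1
    funext p
    simp only [Function.comp]
    rw [ih hl]
    · refine resample_congr (fun k hk => ?_) _
      have : k ≠ i := fun h => hi (h ▸ hk)
      simp [this]
    · intro k hk j hj
      have : k ≠ i := fun h => hi (h ▸ hk)
      simpa [this] using hc k (by simp [hk]) j hj

theorem runSteps_send (l : List (Fin n)) (hl : l.Nodup) (c : Config n Mem Msg)
    (hc : ∀ i ∈ l, (c.state i).sent = false) :
    A.runSteps (l.map Step.send) c = PMF.pure
      { state := fun i => if i ∈ l then { c.state i with sent := true } else c.state i
        buffer := fun i => if i ∈ l then fun j => some (A.message i (c.state i) j)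
          else c.buffer i } := by
  induction l generalizing c with
  | nil => simp [runSteps]
  | cons i l ih =>
    obtain ⟨hi, hl⟩ := List.nodup_cons.1 hl
    simp only [List.map_cons, runSteps, stepDist, hc i (by simp), Bool.false_eq_true, if_false,
      PMF.pure_bind]
    rw [ih hl]
    · congr 2
      · funext k
        by_cases hk : k = i
        · subst hk; simp [hi]
        · simp [hk]
      · funext k
        by_cases hk : k = i
        · subst hk; simp [hi]
        · simp [hk]
    · intro k hk
      have : k ≠ i := fun h => hi (h ▸ hk)
      simpa [this] using hc k (by simp [hk])

/-- The state of a processor after a resetting step. -/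
def resetProc (p : ProcState Mem) : ProcState Mem :=
  { p with mem := A.blank, resets := p.resets + 1, sent := false }

/-- The states of all processors after the processors in `R` have been reset. -/
def resetStates (R : Finset (Fin n)) (W : Fin n → ProcState Mem) : Fin n → ProcState Mem :=
  fun i => if i ∈ R then A.resetProc (W i) else W i

theorem resetStates_empty (W : Fin n → ProcState Mem) : A.resetStates ∅ W = W := by
  funext i; simp [resetStates]

theorem resetStates_output (R : Finset (Fin n)) (W : Fin n → ProcState Mem) (i : Fin n) :
    (A.resetStates R W i).output = (W i).output := by
  unfold resetStates; split_ifs <;> rfl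

theorem resetStates_sent {R : Finset (Fin n)} {W : Fin n → ProcState Mem} {i : Fin n}
    (h : (W i).sent = false) : (A.resetStates R W i).sent = false := by
  unfold resetStates; split_ifs
  exacts [rfl, h]

theorem runSteps_reset (l : List (Fin n)) (hl : l.Nodup) (c : Config n Mem Msg) :
    A.runSteps (l.map Step.reset) c = PMF.pure
      { c with state := fun i => if i ∈ l then A.resetProc (c.state i) else c.state i } := by
  induction l generalizing c with
  | nil => simp [runSteps]
  | cons i l ih =>
    obtain ⟨hi, hl⟩ := List.nodup_cons.1 hl
    simp only [List.map_cons, runSteps, stepDist, PMF.pure_bind]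
    rw [ih hl]
    congr 2
    funext k
    by_cases hk : k = i
    · subst hk; simp [hi, resetProc]
    · simp [hk]

/-- The distribution of the state of processor `i` after the sending steps and receiving steps of a
window that starts with the states `W` and in which `i` hears from the processors in `s`. -/
noncomputable def procNext (W : Fin n → ProcState Mem) (i : Fin n) (s : Finset (Fin n)) :
    PMF (ProcState Mem) :=
  A.procRun i (fun j => A.message j (W j) i) s.toList { W i with sent := true }

/-- The distribution of the processor states after the sending steps and receiving steps of a window
that starts with the states `W` and in which each `i` hears from the processors in `S i`: a product
distribution. All coordinates are resampled, so that the vector from which `resample` starts does not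
matter. -/
noncomputable def next (W : Fin n → ProcState Mem) (S : Fin n → Finset (Fin n)) :
    PMF (Fin n → ProcState Mem) :=
  resample (fun i => A.procNext W i (S i)) (List.finRange n)
    fun i => { W i with sent := true }

theorem mem_support_next {W X : Fin n → ProcState Mem} {S : Fin n → Finset (Fin n)} :
    X ∈ (A.next W S).support ↔ ∀ i, X i ∈ (A.procNext W i (S i)).support := by
  simp [next, mem_support_resample (List.nodup_finRange n)]

theorem map_state_runSteps_sendReceive (S : Fin n → Finset (Fin n)) (c : Config n Mem Msg)
    (hc : ∀ i, (c.state i).sent = false) :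
    (A.runSteps (sendReceive S) c).map Config.state = A.next c.state S := by
  rw [sendReceive, runSteps_append, A.runSteps_send _ (List.nodup_finRange n) c fun i _ => hc i,
    PMF.pure_bind]
  rw [A.map_state_runSteps_receive (fun i j => A.message j (c.state j) i) _
    (fun i => Finset.nodup_toList _) _ (List.nodup_finRange n)]
  · simp only [List.mem_finRange, if_true]
    rfl
  · simp

theorem runSteps_resetFinset (R : Finset (Fin n)) (c : Config n Mem Msg) :
    A.runSteps (R.toList.map Step.reset) c
      = PMF.pure { c with state := A.resetStates R c.state } := by
  rw [A.runSteps_reset _ (Finset.nodup_toList R)]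
  simp only [Finset.mem_toList]
  rfl

/-- Messages that are in the buffer before the window play no role, as they are overwritten in the
sending steps. -/
theorem map_state_runSteps_move (v : Move n) (c : Config n Mem Msg)
    (hc : ∀ i, (c.state i).sent = false) :
    (A.runSteps v.steps c).map Config.state = A.next (A.resetStates v.reset c.state) v.hear := by
  rw [Move.steps, runSteps_append, runSteps_resetFinset, PMF.pure_bind,
    A.map_state_runSteps_sendReceive]
  exact fun i => A.resetStates_sent (hc i)

theorem next_sent {t : ℕ} (ht : t < n) {W X : Fin n → ProcState Mem} {S : Fin n → Finset (Fin n)}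
    (hS : ∀ i, n ≤ (S i).card + t) (hX : X ∈ (A.next W S).support) (i : Fin n) :
    (X i).sent = false := by
  refine (A.procRun_invariants (A.mem_support_next.1 hX i)).2.2.2 (Or.inl ?_)
  intro h
  rw [Finset.toList_eq_nil] at h
  have := hS i
  rw [h, Finset.card_empty] at this
  omega

theorem next_input {W X : Fin n → ProcState Mem} {S : Fin n → Finset (Fin n)}
    (hX : X ∈ (A.next W S).support) (i : Fin n) : (X i).input = (W i).input :=
  (A.procRun_invariants (A.mem_support_next.1 hX i)).1

theorem next_resets {W X : Fin n → ProcState Mem} {S : Fin n → Finset (Fin n)}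
    (hX : X ∈ (A.next W S).support) (i : Fin n) : (X i).resets = (W i).resets :=
  (A.procRun_invariants (A.mem_support_next.1 hX i)).2.1

theorem next_output {W X : Fin n → ProcState Mem} {S : Fin n → Finset (Fin n)}
    (hX : X ∈ (A.next W S).support) {i : Fin n} {b : Bool} (h : (W i).output = some b) :
    (X i).output = some b :=
  (A.procRun_invariants (A.mem_support_next.1 hX i)).2.2.1 b h

/-! ### Adversaries that play move by move -/

/-- The distribution of the partial execution obtained from `e` by taking a list of steps. -/
noncomputable def execSteps : List (Step n) → Exec n Mem Msg → PMF (Exec n Mem Msg)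
  | [], e => PMF.pure e
  | s :: l, e => (A.stepDist (A.last e) s).bind fun c => execSteps l (.snoc e s c)

theorem map_last_execSteps (l : List (Step n)) (e : Exec n Mem Msg) :
    (A.execSteps l e).map A.last = A.runSteps l (A.last e) := by
  induction l generalizing e with
  | nil => simp [execSteps, runSteps, PMF.pure_map]
  | cons s l ih =>
    simp only [execSteps, runSteps, PMF.map_bind, ih]
    rfl

theorem execSteps_support {l : List (Step n)} {e e' : Exec n Mem Msg}
    (h : e' ∈ (A.execSteps l e).support) :
    e'.schedule = e.schedule ++ l ∧ (A.prob e ≠ 0 → A.prob e' ≠ 0) := by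
  induction l generalizing e with
  | nil =>
    simp only [execSteps, PMF.support_pure, Set.mem_singleton_iff] at h
    subst h
    simp
  | cons s l ih =>
    simp only [execSteps, PMF.mem_support_bind_iff] at h
    obtain ⟨c, hc, h⟩ := h
    obtain ⟨h1, h2⟩ := ih h
    refine ⟨by simp [h1, Exec.schedule], fun he => h2 ?_⟩
    exact mul_ne_zero he ((PMF.mem_support_iff _ _).1 hc)

/-- The distribution of the partial execution obtained from `e` by `N` further steps under the
control of `adv`. -/
noncomputable def runFrom (adv : Adversary n Mem Msg) : ℕ → Exec n Mem Msg → PMF (Exec n Mem Msg)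
  | 0, e => PMF.pure e
  | N + 1, e => (A.stepDist (A.last e) (adv e)).bind fun c => runFrom adv N (.snoc e (adv e) c)

theorem runFrom_add (adv : Adversary n Mem Msg) (M N : ℕ) (e : Exec n Mem Msg) :
    A.runFrom adv (M + N) e = (A.runFrom adv M e).bind (A.runFrom adv N) := by
  induction M generalizing e with
  | zero => simp [runFrom]
  | succ M ih =>
    rw [Nat.add_right_comm]
    simp [runFrom, ih, PMF.bind_bind]

theorem run_eq_runFrom (adv : Adversary n Mem Msg) (inputs : Fin n → Bool) (N : ℕ) :
    A.run adv inputs N = A.runFrom adv N (.start inputs) := by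
  induction N with
  | zero => rfl
  | succ N ih =>
    rw [runFrom_add, run, ih]
    congr 1

theorem isPrefix_of_mem_runFrom {adv : Adversary n Mem Msg} {N : ℕ} {e e' : Exec n Mem Msg}
    (h : e' ∈ (A.runFrom adv N e).support) : e.IsPrefix e' := by
  induction N generalizing e with
  | zero =>
    simp only [runFrom, PMF.support_pure, Set.mem_singleton_iff] at h
    subst h
    exact .refl _
  | succ N ih =>
    simp only [runFrom, PMF.mem_support_bind_iff] at h
    obtain ⟨c, -, h⟩ := h
    exact (ih h).of_snoc

/-- The number of moves that have been completed after a partial execution controlled by the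
strategy, and the steps of the current move that remain to be taken. -/
noncomputable def pending (σ : Strategy n Mem) : Exec n Mem Msg → ℕ × List (Step n)
  | .start inputs => (0, (σ 0 (A.initial inputs).state).steps)
  | .snoc e _ c => match (pending σ e).2.tail with
    | [] => ((pending σ e).1 + 1, (σ ((pending σ e).1 + 1) c.state).steps)
    | s :: l => ((pending σ e).1, s :: l)

/-- The adversary that takes the steps of the moves prescribed by a strategy. -/
noncomputable def follow [NeZero n] (σ : Strategy n Mem) : Adversary n Mem Msg :=
  fun e => (A.pending σ e).2.headD (.send 0)

/-- After `e`, exactly `k` moves are completed and the next move has not begun. -/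
def MoveBoundary (σ : Strategy n Mem) (k : ℕ) (e : Exec n Mem Msg) : Prop :=
  A.pending σ e = (k, (σ k (A.last e).state).steps)

theorem moveBoundary_start (σ : Strategy n Mem) (inputs : Fin n → Bool) :
    A.MoveBoundary σ 0 (.start inputs) := rfl

section Follow

variable {A} {σ : Strategy n Mem} {k : ℕ} {e : Exec n Mem Msg} {s : Step n} {l : List (Step n)}

theorem pending_snoc_of_ne_nil (h : A.pending σ e = (k, s :: l)) (hl : l ≠ []) (s' : Step n)
    (c : Config n Mem Msg) : A.pending σ (.snoc e s' c) = (k, l) := by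
  cases l with
  | nil => exact absurd rfl hl
  | cons a l => simp [pending, h]

theorem moveBoundary_snoc (h : A.pending σ e = (k, [s])) (s' : Step n) (c : Config n Mem Msg) :
    A.MoveBoundary σ (k + 1) (.snoc e s' c) := by
  simp [MoveBoundary, pending, h, last]

theorem moveBoundary_of_mem_execSteps (h : A.pending σ e = (k, l)) (hl : l ≠ [])
    {e' : Exec n Mem Msg} (he' : e' ∈ (A.execSteps l e).support) :
    A.MoveBoundary σ (k + 1) e' := by
  induction l generalizing e with
  | nil => exact absurd rfl hl
  | cons s l ih =>
    simp only [execSteps, PMF.mem_support_bind_iff] at he'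
    obtain ⟨c, -, he'⟩ := he'
    rcases eq_or_ne l [] with rfl | hl
    · simp only [execSteps, PMF.support_pure, Set.mem_singleton_iff] at he'
      subst he'
      exact moveBoundary_snoc h s c
    · exact ih (pending_snoc_of_ne_nil h hl s c) hl he'

variable [NeZero n]

theorem follow_eq (h : A.pending σ e = (k, s :: l)) : A.follow σ e = s := by
  simp [follow, h]

/-- While `follow σ` carries out a move, it takes the fixed sequence of pending steps. -/
theorem runFrom_follow (h : A.pending σ e = (k, l)) (N : ℕ) :
    A.runFrom (A.follow σ) (l.length + N) e
      = (A.execSteps l e).bind (A.runFrom (A.follow σ) N) := by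
  induction l generalizing e with
  | nil => simp [execSteps]
  | cons s l ih =>
    rw [List.length_cons, Nat.add_right_comm, runFrom, execSteps, follow_eq h, PMF.bind_bind]
    congr 1
    funext c
    rcases eq_or_ne l [] with rfl | hl
    · simp [execSteps]
    · exact ih (pending_snoc_of_ne_nil h hl s c)

/-- In an infinite execution under `follow σ`, the pending steps are taken in order, and the next move
begins when none is left. -/
theorem infiniteExec_segment {f : ℕ → Exec n Mem Msg} (hf : A.IsInfiniteExec (A.follow σ) f)
    {N : ℕ} {l' : List (Step n)} (h : A.pending σ (f N) = (k, l ++ l')) :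
    (f (N + l.length)).schedule = (f N).schedule ++ l ∧
      (l' = [] → l ≠ [] → A.MoveBoundary σ (k + 1) (f (N + l.length))) := by
  induction l generalizing N with
  | nil => simp
  | cons s l ih =>
    obtain ⟨c, -, hc⟩ := hf.2 N
    rw [follow_eq h] at hc
    rcases eq_or_ne (l ++ l') [] with h0 | h0
    · obtain ⟨rfl, rfl⟩ := List.append_eq_nil_iff.1 h0
      simp only [List.length_singleton, hc, Exec.schedule, true_and]
      exact fun _ _ => moveBoundary_snoc h s c
    · have hp := pending_snoc_of_ne_nil h h0 s c
      rw [← hc] at hp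
      obtain ⟨h1, h2⟩ := ih hp
      rw [List.length_cons, add_comm l.length, ← add_assoc]
      refine ⟨by rw [h1, hc]; simp [Exec.schedule], fun h' _ => h2 h' ?_⟩
      subst h'
      simpa using h0

/-- A move begins with the resets of the current window and ends with the receiving steps of the next
one, so the `k`-th window consists of the end of the `k`-th move and the beginning of its
successor. -/
theorem isStronglyAdaptive_follow {t : ℕ} (hσ : σ.Legal t) :
    A.IsStronglyAdaptive t (A.follow σ) := by
  intro f hf
  -- `N k` is the time at which the `k`-th move is completed
  let N : ℕ → ℕ := fun k => Nat.rec 0 (fun _ M => M + (A.pending σ (f M)).2.length) k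
  have hNs : ∀ k, N (k + 1) = N k + (A.pending σ (f (N k))).2.length := fun k => rfl
  have hN : ∀ k, A.MoveBoundary σ k (f (N k)) := by
    intro k
    induction k with
    | zero =>
      obtain ⟨inputs, h⟩ := hf.1
      change A.MoveBoundary σ 0 (f 0)
      rw [h]
      exact A.moveBoundary_start σ inputs
    | succ k ih =>
      rw [hNs, ih]
      exact (infiniteExec_segment hf (l' := []) (by rw [ih, List.append_nil])).2 rfl
        (Move.steps_ne_nil _)
  let v : ℕ → Move n := fun k => σ k (A.last (f (N k))).state
  refine ⟨fun k => sendReceive (v k).hear ++ (v (k + 1)).reset.toList.map Step.reset,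
    fun k => isAcceptableWindow_sendReceive (hσ.1 _ _).2 (hσ.1 _ _).1, fun k => ?_⟩
  refine ⟨N k + ((v k).reset.toList.map Step.reset).length, ?_⟩
  rw [(infiniteExec_segment hf (hN k)).1]
  induction k with
  | zero =>
    obtain ⟨inputs, h⟩ := hf.1
    change (f 0).schedule ++ _ = _
    simp [h, Exec.schedule, v, hσ.2]
  | succ k ih =>
    have := (infiniteExec_segment hf (l' := []) (k := k)
      (by rw [hN k, List.append_nil])).1
    have hN' : N (k + 1) = N k + (v k).steps.length := by rw [hNs, hN k]
    have hsch : (f (N (k + 1))).schedule = (f (N k)).schedule ++ (v k).steps := by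
      rw [hN']; exact this
    rw [hsch, List.range_succ, List.map_append, List.flatten_append, ← ih]
    simp [Move.steps, v]

end Follow

end Algorithm

/-! ### Executions at the boundaries of moves -/

namespace Algorithm

variable (A : Algorithm n Mem Msg)

theorem map_state_execSteps_move (v : Move n) (e : Exec n Mem Msg)
    (he : ∀ i, ((A.last e).state i).sent = false) :
    (A.execSteps v.steps e).map (fun e' => (A.last e').state)
      = A.next (A.resetStates v.reset (A.last e).state) v.hear := by
  rw [← A.map_state_runSteps_move v _ he, ← map_last_execSteps, PMF.map_comp]
  rfl

/-- After `e`, exactly `k` moves are completed, the next one has not begun, and `e` is a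
concatenation of `k` windows, the last of which may still be extended by resetting steps. -/
structure WindowBoundary (t : ℕ) (σ : Strategy n Mem) (k : ℕ) (e : Exec n Mem Msg) : Prop where
  boundary : A.MoveBoundary σ k e
  sent (i : Fin n) : ((A.last e).state i).sent = false
  windows (R : Finset (Fin n)) : R.card ≤ t → (k = 0 → R = ∅) →
    IsWindowSeq t k (e.schedule ++ R.toList.map Step.reset)

variable {A} {t k : ℕ} {σ : Strategy n Mem}

theorem windowBoundary_start (inputs : Fin n → Bool) :
    A.WindowBoundary t σ 0 (.start inputs) where
  boundary := A.moveBoundary_start σ inputs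
  sent _ := rfl
  windows R _ hR := ⟨[], rfl, by simp, by simp [hR rfl, Exec.schedule]⟩

theorem state_mem_support_next {v : Move n} {e e' : Exec n Mem Msg}
    (he : ∀ i, ((A.last e).state i).sent = false) (he' : e' ∈ (A.execSteps v.steps e).support) :
    (A.last e').state ∈ (A.next (A.resetStates v.reset (A.last e).state) v.hear).support := by
  rw [← A.map_state_execSteps_move v e he, PMF.mem_support_map_iff]
  exact ⟨e', he', rfl⟩

theorem WindowBoundary.move [NeZero n] (ht : t < n) (hσ : σ.Legal t) {e e' : Exec n Mem Msg}
    (he : A.WindowBoundary t σ k e)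
    (he' : e' ∈ (A.execSteps (σ k (A.last e).state).steps e).support) :
    A.WindowBoundary t σ (k + 1) e' where
  boundary := moveBoundary_of_mem_execSteps he.boundary (Move.steps_ne_nil _) he'
  sent := A.next_sent ht (hσ.1 _ _).2 (state_mem_support_next he.sent he')
  windows R hR _ := by
    obtain ⟨ws, h1, h2, h3⟩ := he.windows (σ k (A.last e).state).reset (hσ.1 _ _).1
      (fun h => by subst h; exact hσ.2 _)
    refine ⟨ws ++ [sendReceive (σ k (A.last e).state).hear ++ R.toList.map Step.reset],
      by simp [h1], ?_, ?_⟩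
    · intro w hw
      rcases List.mem_append.1 hw with hw | hw
      · exact h2 w hw
      · rw [List.mem_singleton.1 hw]
        exact isAcceptableWindow_sendReceive (hσ.1 _ _).2 hR
    · rw [(A.execSteps_support he').1, List.flatten_append, h3]
      simp [Move.steps]

theorem WindowBoundary.runFrom_eq [NeZero n] {e : Exec n Mem Msg}
    (he : A.WindowBoundary t σ k e) (N : ℕ) :
    A.runFrom (A.follow σ) ((σ k (A.last e).state).steps.length + N) e
      = (A.execSteps (σ k (A.last e).state).steps e).bind (A.runFrom (A.follow σ) N) :=
  runFrom_follow he.boundary N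

/-! ### States reachable by moves -/

variable (A)

/-- `X` can result from the first `k` of the moves `v`, for the given input bits. -/
def Chain (inputs : Fin n → Bool) (v : ℕ → Move n) : ℕ → (Fin n → ProcState Mem) → Prop
  | 0, X => X = (A.initial inputs).state
  | k + 1, X' => ∃ X, Chain inputs v k X ∧
      X' ∈ (A.next (A.resetStates (v k).reset X) (v k).hear).support

/-- `W` is the vector of states at the end of some sequence of windows that has non-zero probability
and is given by legal moves fixed in advance. -/
def Reach (t : ℕ) (W : Fin n → ProcState Mem) : Prop :=
  ∃ (inputs : Fin n → Bool) (v : ℕ → Move n) (k : ℕ) (X : Fin n → ProcState Mem),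
    Strategy.Legal (Mem := Mem) t (fun k _ => v k) ∧ A.Chain inputs v k X ∧
      W = A.resetStates (v k).reset X

variable {A}

theorem Chain.congr {inputs : Fin n → Bool} {v v' : ℕ → Move n} {X : Fin n → ProcState Mem}
    (hX : A.Chain inputs v k X) (h : ∀ l < k, v' l = v l) : A.Chain inputs v' k X := by
  induction k generalizing X with
  | zero => exact hX
  | succ k ih =>
    obtain ⟨Y, hY, hX⟩ := hX
    refine ⟨Y, ih hY fun l hl => h l (by omega), ?_⟩
    rwa [h k (by omega)]

theorem reach_initial (inputs : Fin n → Bool) : A.Reach t (A.initial inputs).state :=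
  ⟨inputs, fun _ => ⟨∅, fun _ => Finset.univ⟩, 0, _, ⟨fun _ _ => ⟨by simp, by simp⟩, by simp⟩, rfl,
    (A.resetStates_empty _).symm⟩

theorem Reach.next {W X : Fin n → ProcState Mem} (hW : A.Reach t W) {S : Fin n → Finset (Fin n)}
    (hS : ∀ i, n ≤ (S i).card + t) (hX : X ∈ (A.next W S).support) {R : Finset (Fin n)}
    (hR : R.card ≤ t) : A.Reach t (A.resetStates R X) := by
  obtain ⟨inputs, v, k, Y, hv, hY, rfl⟩ := hW
  refine ⟨inputs, fun l => if l < k then v l else if l = k then ⟨(v k).reset, S⟩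
    else ⟨R, fun _ => Finset.univ⟩, k + 1, X, ⟨fun l Z => ?_, fun Z => ?_⟩, ?_, by simp⟩
  · dsimp only
    split_ifs
    · exact hv.1 l Z
    · exact ⟨(hv.1 k Z).1, hS⟩
    · exact ⟨hR, by simp⟩
  · dsimp only
    split_ifs with h1 h2
    · exact hv.2 Z
    · subst h2; exact hv.2 Z
    · omega
  · refine ⟨Y, hY.congr fun l hl => by simp [hl], ?_⟩
    simpa using hX

theorem Reach.next' {W X : Fin n → ProcState Mem} (hW : A.Reach t W) {S : Fin n → Finset (Fin n)}
    (hS : ∀ i, n ≤ (S i).card + t) (hX : X ∈ (A.next W S).support) : A.Reach t X := by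
  have := hW.next hS hX (R := ∅) (by simp)
  rwa [A.resetStates_empty] at this

theorem Chain.exists_exec [NeZero n] (ht : t < n) {inputs : Fin n → Bool} {v : ℕ → Move n}
    (hv : Strategy.Legal (Mem := Mem) t fun k _ => v k) {X : Fin n → ProcState Mem}
    (hX : A.Chain inputs v k X) :
    ∃ N, ∃ e ∈ (A.runFrom (A.follow fun k _ => v k) N (.start inputs)).support,
      A.WindowBoundary t (fun k _ => v k) k e ∧ (A.last e).state = X ∧ A.prob e ≠ 0 := by
  induction k generalizing X with
  | zero =>
    refine ⟨0, .start inputs, by simp [runFrom], windowBoundary_start inputs, hX.symm, ?_⟩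
    simp [prob]
  | succ k ih =>
    obtain ⟨Y, hY, hX⟩ := hX
    obtain ⟨N, e, he, hb, rfl, hp⟩ := ih hY
    rw [← A.map_state_execSteps_move (v k) e hb.sent, PMF.mem_support_map_iff] at hX
    obtain ⟨e', he', rfl⟩ := hX
    refine ⟨N + ((v k).steps.length + 0), e', ?_, hb.move ht hv he', rfl,
      (A.execSteps_support he').2 hp⟩
    rw [runFrom_add, PMF.mem_support_bind_iff]
    refine ⟨e, he, ?_⟩
    rw [hb.runFrom_eq 0, PMF.mem_support_bind_iff]
    exact ⟨e', he', by simp [runFrom]⟩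

theorem Reach.exists_reachable [NeZero n] (ht : t < n) {W : Fin n → ProcState Mem}
    (hW : A.Reach t W) : ∃ c, A.Reachable t c ∧ c.state = W := by
  obtain ⟨inputs, v, k, X, hv, hX, rfl⟩ := hW
  obtain ⟨N, e, -, hb, rfl, hp⟩ := hX.exists_exec ht hv
  obtain ⟨e', he'⟩ := (A.execSteps ((v k).reset.toList.map Step.reset) e).support_nonempty
  have hl : A.last e' ∈ ((A.execSteps ((v k).reset.toList.map Step.reset) e).map A.last).support :=
    (PMF.mem_support_map_iff _ _ _).2 ⟨e', he', rfl⟩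
  rw [map_last_execSteps, runSteps_resetFinset, PMF.support_pure, Set.mem_singleton_iff] at hl
  obtain ⟨h1, h2⟩ := A.execSteps_support he'
  refine ⟨A.last e', ⟨e', h2 hp, ⟨k, ?_⟩, rfl⟩, by rw [hl]⟩
  rw [h1]
  refine hb.windows _ (hv.1 k (A.last e).state).1 fun h => ?_
  subst h
  exact hv.2 (A.last e).state

/-! ### Silencing a set of processors forever -/

variable (A) in
/-- `Y` can result from `W` by `k` windows without resets in which nobody hears from `T`. -/
def Silent (T : Finset (Fin n)) (W : Fin n → ProcState Mem) : ℕ → (Fin n → ProcState Mem) → Prop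
  | 0, Y => Y = W
  | k + 1, Y' => ∃ Y, Silent T W k Y ∧ Y' ∈ (A.next Y fun _ => Tᶜ).support

theorem le_card_compl {T : Finset (Fin n)} (hT : T.card ≤ t) : n ≤ Tᶜ.card + t := by
  rw [Finset.card_compl, Fintype.card_fin]
  omega

theorem Silent.reach {T : Finset (Fin n)} (hT : T.card ≤ t) {W Y : Fin n → ProcState Mem}
    (hW : A.Reach t W) (hY : A.Silent T W k Y) : A.Reach t Y := by
  induction k generalizing Y with
  | zero => exact hY ▸ hW
  | succ k ih =>
    obtain ⟨X, hX, hY⟩ := hY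
    exact (ih hX).next' (fun _ => le_card_compl hT) hY

theorem Silent.output {T : Finset (Fin n)} {W Y : Fin n → ProcState Mem}
    (hY : A.Silent T W k Y) {i : Fin n} {b : Bool} (h : (W i).output = some b) :
    (Y i).output = some b := by
  induction k generalizing Y with
  | zero => exact hY ▸ h
  | succ k ih =>
    obtain ⟨X, hX, hY⟩ := hY
    exact A.next_output hY (ih hX)

theorem procRun_congr {i : Fin n} {msg msg' : Fin n → Msg} {js : List (Fin n)}
    (h : ∀ j ∈ js, msg j = msg' j) (p : ProcState Mem) :
    A.procRun i msg js p = A.procRun i msg' js p := by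
  induction js generalizing p with
  | nil => rfl
  | cons j js ih =>
    simp only [procRun, h j (by simp)]
    congr 1
    funext r
    exact ih (fun j hj => h j (by simp [hj])) _

theorem procNext_congr {W W' : Fin n → ProcState Mem} {i : Fin n} {s : Finset (Fin n)}
    (hi : W i = W' i) (h : ∀ j ∈ s, W j = W' j) : A.procNext W i s = A.procNext W' i s := by
  unfold procNext
  rw [hi]
  exact procRun_congr (fun j hj => by rw [h j (Finset.mem_toList.1 hj)]) _

/-- The processors outside `T` cannot distinguish between `W` and `W'`. -/
theorem Silent.couple {T : Finset (Fin n)} {W W' Y : Fin n → ProcState Mem}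
    (hW : ∀ i ∉ T, W i = W' i) (hY : A.Silent T W k Y) :
    ∃ Y', A.Silent T W' k Y' ∧ ∀ i ∉ T, Y i = Y' i := by
  classical
  induction k generalizing Y with
  | zero => exact ⟨W', rfl, hY ▸ hW⟩
  | succ k ih =>
    obtain ⟨X, hX, hY⟩ := hY
    obtain ⟨X', hX', hXX'⟩ := ih hX
    choose z hz using fun i => (A.procNext X' i Tᶜ).support_nonempty
    refine ⟨fun i => if i ∈ T then z i else Y i, ⟨X', hX', A.mem_support_next.2 fun i => ?_⟩,
      fun i hi => by simp [hi]⟩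
    by_cases hi : i ∈ T
    · simpa [hi] using hz i
    · simp only [hi, if_false]
      rw [← procNext_congr (hXX' i hi) fun j hj => hXX' j (Finset.mem_compl.1 hj)]
      exact A.mem_support_next.1 hY i

/-- Because of termination, every processor may decide although `T` is silenced forever. -/
theorem exists_silent_decision [NeZero n] (ht : t < n) (hterm : A.MeasureOneTermination t)
    {W : Fin n → ProcState Mem} (hW : A.Reach t W) {T : Finset (Fin n)} (hT : T.card ≤ t)
    (i : Fin n) : ∃ k Y, A.Silent T W k Y ∧ (Y i).output ≠ none := by
  by_contra! hno
  obtain ⟨inputs, v, k, X, hv, hX, rfl⟩ := hW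
  let v' : ℕ → Move n := fun l => if l < k then v l else
    ⟨if l = k then (v k).reset else ∅, fun _ => Tᶜ⟩
  have hv' : Strategy.Legal (Mem := Mem) t fun k _ => v' k := by
    refine ⟨fun l Z => ?_, fun Z => ?_⟩
    · simp only [v']
      split_ifs
      · exact hv.1 l Z
      · exact ⟨(hv.1 k Z).1, fun _ => le_card_compl hT⟩
      · exact ⟨by simp, fun _ => le_card_compl hT⟩
    · simp only [v']
      split_ifs with h1 h2
      · exact hv.2 Z
      · subst h2; exact hv.2 Z
      · rfl
  obtain ⟨N₀, e₀, he₀, hb₀, hX₀, -⟩ :=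
    (hX.congr (v' := v') fun l hl => by simp [v', hl]).exists_exec ht hv'
  set σ : Strategy n Mem := fun k _ => v' k with hσ
  -- the lengths of the moves do not depend on the execution, which allows for a common bound `N`
  have key : ∀ r j, ∃ N, r ≤ N ∧ ∀ e, A.WindowBoundary t σ (k + j) e →
      A.Silent T (A.resetStates (v k).reset X) j
        (A.resetStates (v' (k + j)).reset (A.last e).state) →
      ∀ e' ∈ (A.runFrom (A.follow σ) N e).support, ((A.last e').state i).output = none := by
    intro r
    induction r with
    | zero =>
      intro j
      refine ⟨0, le_rfl, fun e _ hs e' he' => ?_⟩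
      simp only [runFrom, PMF.support_pure, Set.mem_singleton_iff] at he'
      rw [he', ← hno j _ hs, resetStates_output]
    | succ r ih =>
      intro j
      obtain ⟨N, hN, h⟩ := ih (j + 1)
      have hpos : 0 < (v' (k + j)).steps.length := List.length_pos_iff.2 (Move.steps_ne_nil _)
      refine ⟨(v' (k + j)).steps.length + N, by omega, fun e he hs e' he' => ?_⟩
      have hrun := he.runFrom_eq N
      simp only [hσ] at hrun he'
      rw [hrun, PMF.mem_support_bind_iff] at he'
      obtain ⟨e₁, he₁, he'⟩ := he'
      refine h e₁ (he.move ht hv' he₁) ?_ e' he'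
      have h0 : v' (k + (j + 1)) = ⟨∅, fun _ => Tᶜ⟩ := by simp [v']
      rw [h0, resetStates_empty]
      refine ⟨_, hs, ?_⟩
      have h1 : (v' (k + j)).hear = fun _ => Tᶜ := by simp [v']
      have := state_mem_support_next he.sent he₁
      rwa [h1] at this
  have hlim := hterm (A.follow σ) (isStronglyAdaptive_follow hv') inputs i
  have hpos : 0 < A.runFrom (A.follow σ) N₀ (.start inputs) e₀ :=
    pos_iff_ne_zero.2 ((PMF.mem_support_iff _ _).1 he₀)
  obtain ⟨M, hM⟩ := Filter.eventually_atTop.1 (hlim.eventually (gt_mem_nhds hpos))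
  obtain ⟨N, hN, h⟩ := key M 0
  have hcontra := hM (N₀ + N) (by omega)
  refine absurd hcontra (not_lt.2 ?_)
  rw [run_eq_runFrom, runFrom_add, toOuterMeasure_eq_expect, expect_bind]
  refine le_trans (le_of_eq ?_) (apply_mul_le_expect _ e₀ _)
  rw [← toOuterMeasure_eq_expect,
    (PMF.toOuterMeasure_apply_eq_one_iff _ _).2, mul_one]
  refine h e₀ hb₀ ?_
  rw [hX₀]
  simp [Silent, v']

end Algorithm

namespace Algorithm

/-! ### States in which one value is hard to avoid -/

section Valence

variable (A : Algorithm n Mem Msg) (t : ℕ) (θ : ℕ → ℝ≥0∞)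

/-- The reachable vectors of states from which an adversary cannot reliably prevent the decision `b`
for `k` windows: some processor has decided `b`, or `k` is positive and, whoever hears from whom in
the next window, with probability more than `θ (k - 1)` no choice of resets leads out of the set for
`k - 1`. -/
def Valent (b : Bool) : ℕ → Set (Fin n → ProcState Mem)
  | 0 => {W | A.Reach t W ∧ ∃ i, (W i).output = some b}
  | k + 1 => {W | A.Reach t W ∧ ∀ S : Fin n → Finset (Fin n), (∀ i, n ≤ (S i).card + t) →
      θ k < (A.next W S).toOuterMeasure
        {X | ∀ R : Finset (Fin n), R.card ≤ t → A.resetStates R X ∈ Valent b k}}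

/-- The vectors of states for which no choice of resets leads out of `Valent`. -/
def PreValent (b : Bool) (k : ℕ) : Set (Fin n → ProcState Mem) :=
  {X | ∀ R : Finset (Fin n), R.card ≤ t → A.resetStates R X ∈ A.Valent t θ b k}

/-- States that are hard to steer away from different decisions differ at more than `t`
processors. -/
def Separated (k : ℕ) : Prop :=
  ∀ (b : Bool) (W W' : Fin n → ProcState Mem) (T : Finset (Fin n)), T.card ≤ t →
    W ∈ A.Valent t θ b k → W' ∈ A.Valent t θ (!b) k → ¬ ∀ i ∉ T, W i = W' i

variable {A t θ} {b : Bool} {k : ℕ} {W W' X Y : Fin n → ProcState Mem}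

theorem valent_of_preValent (h : X ∈ A.PreValent t θ b k) : X ∈ A.Valent t θ b k := by
  have := h ∅ (by simp)
  rwa [resetStates_empty] at this

theorem reach_of_valent (h : W ∈ A.Valent t θ b k) : A.Reach t W := by
  cases k <;> exact h.1

theorem Reach.valent (hθ : ∀ k, θ k < 1) (hW : A.Reach t W) {i : Fin n}
    (hi : (W i).output = some b) (k : ℕ) : W ∈ A.Valent t θ b k := by
  induction k generalizing W with
  | zero => exact ⟨hW, i, hi⟩
  | succ k ih =>
    refine ⟨hW, fun S hS => ?_⟩
    rw [(PMF.toOuterMeasure_apply_eq_one_iff _ _).2]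
    · exact hθ k
    · intro X hX R hR
      refine ih (hW.next hS hX hR) ?_
      rw [resetStates_output]
      exact A.next_output hX hi

variable [NeZero n]

/-- Validity: a value that is hard to avoid is the decision in some reachable state, so it is the input
of some processor. -/
theorem exists_input_of_valent (ht : t < n) (hcorr : A.MeasureOneCorrectness t)
    (hW : W ∈ A.Valent t θ b k) : ∃ j, (W j).input = b := by
  induction k generalizing W with
  | zero =>
    obtain ⟨hW, i, hi⟩ := hW
    obtain ⟨c, hc, rfl⟩ := hW.exists_reachable ht
    exact (hcorr c hc).2 i b hi
  | succ k ih =>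
    obtain ⟨X, hX, hXv⟩ := exists_mem_of_toOuterMeasure_ne_zero
      (hW.2 (fun _ => Finset.univ) (by simp)).ne_bot
    obtain ⟨j, hj⟩ := ih (valent_of_preValent hXv)
    exact ⟨j, by rw [← hj, A.next_input hX]⟩

/-- With `T` silenced forever, a processor outside `T` may decide on the same value from both states,
and this value contradicts one of the two given decisions. -/
theorem separated_zero (ht : t < n) (hcorr : A.MeasureOneCorrectness t)
    (hterm : A.MeasureOneTermination t) : A.Separated t θ 0 := by
  rintro b W W' T hT ⟨hW, i, hi⟩ ⟨hW', j, hj⟩ h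
  obtain ⟨l, hl⟩ : ∃ l, l ∉ T := by
    by_contra! hall
    rw [Finset.eq_univ_iff_forall.2 hall, Finset.card_univ, Fintype.card_fin] at hT
    omega
  obtain ⟨m, Y, hY, ha⟩ := exists_silent_decision ht hterm hW hT l
  obtain ⟨a, ha⟩ := Option.ne_none_iff_exists'.1 ha
  obtain ⟨Y', hY', hYY'⟩ := hY.couple h
  have ha' : (Y' l).output = some a := by rw [← hYY' l hl, ha]
  obtain ⟨c, hc, rfl⟩ := (hY.reach hT hW).exists_reachable ht
  obtain ⟨c', hc', rfl⟩ := (hY'.reach hT hW').exists_reachable ht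
  have h1 := (hcorr c hc).1 _ _ _ _ (hY.output hi) ha
  have h2 := (hcorr c' hc').1 _ _ _ _ (hY'.output hj) ha'
  rw [← h2] at h1
  cases b <;> simp at h1

omit [NeZero n] in
/-- A processor outside `T` that decided in one of two possible outcomes could have decided in the
other one, too, and this changes only one coordinate. -/
theorem Separated.output_eq_none (hsep : A.Separated t θ k) (hθ : ∀ k, θ k < 1) (ht0 : 0 < t)
    {S S' : Fin n → Finset (Fin n)} (hW : A.Reach t W) (hW' : A.Reach t W')
    (hS : ∀ i, n ≤ (S i).card + t) (hS' : ∀ i, n ≤ (S' i).card + t) {i : Fin n}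
    (hμ : A.procNext W i (S i) = A.procNext W' i (S' i))
    (hX : X ∈ (A.next W S).support) (hY : Y ∈ (A.next W' S').support)
    (hXv : X ∈ A.Valent t θ b k) (hYv : Y ∈ A.Valent t θ (!b) k) : (X i).output = none := by
  by_contra hne
  obtain ⟨a, ha⟩ := Option.ne_none_iff_exists'.1 hne
  by_cases hab : a = b
  · subst hab
    have hZ : Function.update Y i (X i) ∈ (A.next W' S').support := by
      refine A.mem_support_next.2 fun j => ?_
      by_cases hj : j = i
      · subst hj
        rw [Function.update_self, ← hμ]
        exact A.mem_support_next.1 hX j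
      · rw [Function.update_of_ne hj]
        exact A.mem_support_next.1 hY j
    refine hsep a (Function.update Y i (X i)) Y {i} (by rwa [Finset.card_singleton])
      ((hW'.next' hS' hZ).valent hθ (i := i) (by simpa using ha) k) hYv fun j hj => ?_
    simp [Finset.mem_singleton.not.1 hj]
  · have hab : a = !b := by cases a <;> cases b <;> simp_all
    subst hab
    exact hsep b X X ∅ (by simp) hXv ((hW.next' hS hX).valent hθ ha k) fun _ _ => rfl

omit [NeZero n] in
/-- If the transition distributions from `W` and `W'` agree outside a set `T` of at most `t`
processors, then the two values cannot both be hard to avoid. For a positive threshold, by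
concentration there would be outcomes that differ outside `T` at a set of less than `t` processors,
and resetting these processors would make the outcomes agree outside `T`. -/
theorem Separated.not_both (hsep : A.Separated t θ k) (hθ : ∀ k, θ k < 1) (ht0 : 0 < t)
    (hk : k = 0 ∨ ENNReal.ofReal (Real.exp (-(t ^ 2 / (2 * n)))) ≤ θ k * θ k)
    {S S' : Fin n → Finset (Fin n)} (hW : A.Reach t W) (hW' : A.Reach t W')
    (hS : ∀ i, n ≤ (S i).card + t) (hS' : ∀ i, n ≤ (S' i).card + t)
    {T : Finset (Fin n)} (hT : T.card ≤ t) (hWW' : ∀ i ∉ T, W i = W' i)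
    (hμ : ∀ i ∉ T, A.procNext W i (S i) = A.procNext W' i (S' i)) :
    ¬ (θ k < (A.next W S).toOuterMeasure (A.PreValent t θ b k) ∧
      θ k < (A.next W' S').toOuterMeasure (A.PreValent t θ (!b) k)) := by
  rintro ⟨h1, h2⟩
  have hnone : ∀ X ∈ (A.next W S).support, ∀ Y ∈ (A.next W' S').support,
      X ∈ A.PreValent t θ b k → Y ∈ A.PreValent t θ (!b) k →
      ∀ i ∉ T, (X i).output = none ∧ (Y i).output = none := by
    intro X hX Y hY hXv hYv i hi
    refine ⟨hsep.output_eq_none hθ ht0 hW hW' hS hS' (hμ i hi) hX hY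
      (valent_of_preValent hXv) (valent_of_preValent hYv),
      hsep.output_eq_none (b := !b) hθ ht0 hW' hW hS' hS (hμ i hi).symm hY hX
        (valent_of_preValent hYv) ?_⟩
    rw [Bool.not_not]
    exact (valent_of_preValent hXv)
  rcases hk with rfl | hk
  · -- both decisions happen in `T`, so the outcomes can be chosen to agree outside `T`
    obtain ⟨X, hX, hXv⟩ := exists_mem_of_toOuterMeasure_ne_zero h1.ne_bot
    obtain ⟨Y, hY, hYv⟩ := exists_mem_of_toOuterMeasure_ne_zero h2.ne_bot
    obtain ⟨j, hj⟩ := (valent_of_preValent hYv).2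
    have hjT : j ∈ T := by
      by_contra hjT
      rw [(hnone X hX Y hY hXv hYv j hjT).2] at hj
      simp at hj
    let Z : Fin n → ProcState Mem := fun i => if i ∈ T then Y i else X i
    have hZ : Z ∈ (A.next W' S').support := by
      refine A.mem_support_next.2 fun i => ?_
      by_cases hi : i ∈ T
      · simpa only [Z, hi, if_true] using A.mem_support_next.1 hY i
      · simp only [Z, hi, if_false]
        rw [← hμ i hi]
        exact A.mem_support_next.1 hX i
    refine hsep b X Z T hT (valent_of_preValent hXv) ⟨hW'.next' hS' hZ, j, ?_⟩ fun i hi => ?_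
    · simpa [Z, hjT] using hj
    · simp [Z, hi]
  · have hfar : ∀ X ∈ A.PreValent t θ b k ∩ (A.next W S).support,
        ∀ Y ∈ A.PreValent t θ (!b) k ∩ (A.next W' S').support,
        t ≤ (diffOutside T Y X).card := by
      rintro X ⟨hXv, hX⟩ Y ⟨hYv, hY⟩
      by_contra hlt
      refine hsep b _ _ T hT (hXv (diffOutside T Y X) (by omega))
        (hYv (diffOutside T Y X) (by omega)) fun i hi => ?_
      unfold resetStates
      by_cases hd : i ∈ diffOutside T Y X
      · have hin : (X i).input = (Y i).input := by
          rw [A.next_input hX, A.next_input hY, hWW' i hi]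
        have hre : (X i).resets = (Y i).resets := by
          rw [A.next_resets hX, A.next_resets hY, hWW' i hi]
        obtain ⟨o1, o2⟩ := hnone X hX Y hY hXv hYv i hi
        simp only [hd, if_true, resetProc, hin, hre, o1, o2]
      · simp only [hd, if_false]
        rw [mem_diffOutside] at hd
        by_contra hne
        exact hd ⟨hi, fun h => hne h.symm⟩
    have hconc := resample_mul_le_of_far hμ (List.finRange n) (fun i => { W i with sent := true })
      (fun i => { W' i with sent := true }) (fun i hi => by rw [hWW' i hi]) _ _ t hfar
    rw [List.length_finRange] at hconc
    change (A.next W S).toOuterMeasure _ * (A.next W' S').toOuterMeasure _ ≤ _ at hconc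
    rw [PMF.toOuterMeasure_apply_inter_support, PMF.toOuterMeasure_apply_inter_support] at hconc
    exact absurd (hconc.trans hk) (not_le.2 (ENNReal.mul_lt_mul h1 h2))

theorem separated (ht : t < n) (ht0 : 0 < t) (hcorr : A.MeasureOneCorrectness t)
    (hterm : A.MeasureOneTermination t) (hθ : ∀ k, θ k < 1)
    (hθ2 : ∀ k, k = 0 ∨ ENNReal.ofReal (Real.exp (-(t ^ 2 / (2 * n)))) ≤ θ k * θ k) (k : ℕ) :
    A.Separated t θ k := by
  induction k with
  | zero => exact separated_zero ht hcorr hterm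
  | succ k ih =>
    intro b W W' T hT hW hW' h
    have hS : ∀ i : Fin n, n ≤ ((fun _ => Tᶜ) i : Finset (Fin n)).card + t :=
      fun _ => le_card_compl hT
    exact ih.not_both hθ ht0 (hθ2 k) (reach_of_valent hW) (reach_of_valent hW') hS hS hT h
      (fun i hi => procNext_congr (h i hi) fun j hj => h j (Finset.mem_compl.1 hj))
      ⟨hW.2 _ hS, hW'.2 _ hS⟩

/-! ### Avoiding both values -/

omit [NeZero n] in
theorem Separated.exists_hear (hsep : A.Separated t θ k) (hθ : ∀ k, θ k < 1) (ht0 : 0 < t)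
    (hk : k = 0 ∨ ENNReal.ofReal (Real.exp (-(t ^ 2 / (2 * n)))) ≤ θ k * θ k)
    (hW : A.Reach t W) (h : ∀ b, W ∉ A.Valent t θ b (k + 1)) :
    ∃ S : Fin n → Finset (Fin n), (∀ i, n ≤ (S i).card + t) ∧
      ∀ b, (A.next W S).toOuterMeasure (A.PreValent t θ b k) ≤ θ k := by
  have hex : ∀ b, ∃ S : Fin n → Finset (Fin n), (∀ i, n ≤ (S i).card + t) ∧
      (A.next W S).toOuterMeasure (A.PreValent t θ b k) ≤ θ k := by
    intro b
    by_contra! hc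
    exact h b ⟨hW, hc⟩
  obtain ⟨S₀, hS₀, h₀⟩ := hex false
  obtain ⟨S₁, hS₁, h₁⟩ := hex true
  by_contra! hno
  -- replace the sets of `S₀` by those of `S₁` one by one
  have hS : ∀ U : Finset (Fin n), ∀ i, n ≤ (U.piecewise S₁ S₀ i).card + t := fun U i => by
    by_cases hi : i ∈ U
    · simpa [hi] using hS₁ i
    · simpa [hi] using hS₀ i
  have key : ∀ U : Finset (Fin n),
      θ k < (A.next W (U.piecewise S₁ S₀)).toOuterMeasure (A.PreValent t θ true k) := by
    intro U
    induction U using Finset.induction_on with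
    | empty =>
      obtain ⟨b, hb⟩ := hno S₀ hS₀
      cases b
      · exact absurd h₀ (not_le.2 hb)
      · simpa using hb
    | insert i U hi ih =>
      obtain ⟨b, hb⟩ := hno _ (hS (insert i U))
      cases b
      · refine absurd ⟨ih, hb⟩ (hsep.not_both (b := true) hθ ht0 hk hW hW (hS U)
          (hS (insert i U)) (T := {i}) (by rwa [Finset.card_singleton])
          (fun _ _ => rfl) fun j hj => ?_)
        simp [Finset.piecewise, Finset.mem_singleton.not.1 hj]
      · exact hb
  have := key Finset.univ
  rw [Finset.piecewise_univ] at this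
  exact absurd h₁ (not_le.2 this)

omit [NeZero n] in
theorem Separated.exists_reset (hsep : A.Separated t θ k) (ht0 : 0 < t)
    (h : ∀ b, X ∉ A.PreValent t θ b k) :
    ∃ R : Finset (Fin n), R.card ≤ t ∧ ∀ b, A.resetStates R X ∉ A.Valent t θ b k := by
  by_contra! hno
  obtain ⟨b, hb⟩ := hno ∅ (by simp)
  refine h b fun R hR => ?_
  induction R using Finset.induction_on with
  | empty => exact hb
  | insert i R hi ih =>
    have ih := ih ((Finset.card_le_card (Finset.subset_insert i R)).trans hR)
    obtain ⟨b', hb'⟩ := hno _ hR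
    by_cases hbb : b' = b
    · exact hbb ▸ hb'
    · have hbb : b' = !b := by cases b <;> cases b' <;> simp_all
      subst hbb
      refine absurd (fun j hj => ?_) (hsep b _ _ {i} (by rwa [Finset.card_singleton]) ih hb')
      simp [resetStates, Finset.mem_singleton.not.1 hj]

theorem Separated.exists_inputs (hsep : A.Separated t θ k) (ht : t < n) (ht0 : 0 < t)
    (hcorr : A.MeasureOneCorrectness t) :
    ∃ inputs, ∀ b, (A.initial inputs).state ∉ A.Valent t θ b k := by
  by_contra! hno
  have key : ∀ U : Finset (Fin n),
      (A.initial fun i => decide (i ∈ U)).state ∈ A.Valent t θ false k := by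
    intro U
    induction U using Finset.induction_on with
    | empty =>
      obtain ⟨b, hb⟩ := hno fun i => decide (i ∈ (∅ : Finset (Fin n)))
      cases b
      · exact hb
      · obtain ⟨j, hj⟩ := exists_input_of_valent ht hcorr hb
        simp [initial] at hj
    | insert i U hi ih =>
      obtain ⟨b, hb⟩ := hno fun j => decide (j ∈ insert i U)
      cases b
      · exact hb
      · refine absurd (fun j hj => ?_) (hsep false _ _ {i} (by rwa [Finset.card_singleton]) ih hb)
        simp [initial, Finset.mem_singleton.not.1 hj]
  obtain ⟨j, hj⟩ := exists_input_of_valent ht hcorr (key Finset.univ)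
  simp [initial] at hj

end Valence

end Algorithm

namespace Algorithm

/-! ### The adversary that avoids both values -/

/-- From the states `X` after the receiving steps, with `k` of `m` windows completed, resets can
lead to states from which neither value is hard to avoid during the remaining `m - k` windows.
(Before the first window, no resets are possible.) -/
def Avoids (A : Algorithm n Mem Msg) (t : ℕ) (θ : ℕ → ℝ≥0∞) (m k : ℕ)
    (X : Fin n → ProcState Mem) : Prop :=
  ∃ R : Finset (Fin n), R.card ≤ t ∧ (k = 0 → R = ∅) ∧ A.Reach t (A.resetStates R X) ∧
    ∀ b, A.resetStates R X ∉ A.Valent t θ b (m - k)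

variable {A : Algorithm n Mem Msg} {t : ℕ} {θ : ℕ → ℝ≥0∞}

/-- The move depends only on `k` and `X`, so that these moves make up a strategy; where `Avoids` fails,
it is arbitrary. -/
theorem exists_move (hsep : ∀ k, A.Separated t θ k) (hθ : ∀ k, θ k < 1) (ht0 : 0 < t)
    (hθ2 : ∀ k, k = 0 ∨ ENNReal.ofReal (Real.exp (-(t ^ 2 / (2 * n)))) ≤ θ k * θ k)
    (m k : ℕ) (X : Fin n → ProcState Mem) :
    ∃ v : Move n, v.Legal t ∧ (k = 0 → v.reset = ∅) ∧ ∀ j, k + (j + 1) = m → A.Avoids t θ m k X →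
      (∀ b, (A.next (A.resetStates v.reset X) v.hear).toOuterMeasure (A.PreValent t θ b j) ≤ θ j) ∧
      ∀ Y ∈ (A.next (A.resetStates v.reset X) v.hear).support,
        (∀ b, Y ∉ A.PreValent t θ b j) → A.Avoids t θ m (k + 1) Y := by
  by_cases h : ∃ j, k + (j + 1) = m ∧ A.Avoids t θ m k X
  · obtain ⟨j, hj, R, hR, hR0, hreach, hval⟩ := h
    rw [show m - k = j + 1 by omega] at hval
    obtain ⟨S, hS, hP⟩ := (hsep j).exists_hear hθ ht0 (hθ2 j) hreach hval
    refine ⟨⟨R, S⟩, ⟨hR, hS⟩, hR0, fun j' hj' _ => ?_⟩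
    obtain rfl : j' = j := by omega
    refine ⟨hP, fun Y hY hYv => ?_⟩
    obtain ⟨R', hR', h'⟩ := (hsep j').exists_reset ht0 hYv
    refine ⟨R', hR', by simp, hreach.next hS hY hR', ?_⟩
    rwa [show m - (k + 1) = j' by omega]
  · exact ⟨⟨∅, fun _ => Finset.univ⟩, ⟨by simp, by simp⟩, fun _ => rfl,
      fun j hj ha => absurd ⟨j, hj, ha⟩ h⟩

/-- In each of the remaining windows, each of the two values becomes unavoidable with probability at
most the threshold. -/
theorem one_le_prob_undecided_add [NeZero n] (ht : t < n) (hθ : ∀ k, θ k < 1) {m : ℕ}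
    {σ : Strategy n Mem} (hσ : σ.Legal t)
    (hmove : ∀ k X j, k + (j + 1) = m → A.Avoids t θ m k X →
      (∀ b, (A.next (A.resetStates (σ k X).reset X) (σ k X).hear).toOuterMeasure
        (A.PreValent t θ b j) ≤ θ j) ∧
      ∀ Y ∈ (A.next (A.resetStates (σ k X).reset X) (σ k X).hear).support,
        (∀ b, Y ∉ A.PreValent t θ b j) → A.Avoids t θ m (k + 1) Y)
    (j k : ℕ) (hjk : k + j = m) (e : Exec n Mem Msg) (he : A.WindowBoundary t σ k e)
    (ha : A.Avoids t θ m k (A.last e).state) (N : ℕ) (hN : j * (t + (n + n * n)) ≤ N) :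
    1 ≤ (A.runFrom (A.follow σ) N e).toOuterMeasure {e' | A.RunsUndecidedFor t m e'} +
      ∑ l ∈ Finset.range j, 2 * θ l := by
  induction j generalizing k e N with
  | zero =>
    obtain rfl : k = m := by omega
    obtain ⟨R, -, -, hreach, hval⟩ := ha
    rw [(PMF.toOuterMeasure_apply_eq_one_iff _ _).2]
    · exact le_self_add
    · intro e' he'
      refine ⟨e, A.isPrefix_of_mem_runFrom he', ?_, fun i => ?_⟩
      · simpa using he.windows ∅ (by simp) fun _ => rfl
      · by_contra hne
        obtain ⟨b, hb⟩ := Option.ne_none_iff_exists'.1 hne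
        exact hval b (hreach.valent hθ (i := i) (by rw [resetStates_output, hb]) _)
  | succ j ih =>
    obtain ⟨hP, hY⟩ := hmove k _ j hjk ha
    have hlen := Move.length_steps_le (hσ.1 k (A.last e).state)
    obtain ⟨N', rfl⟩ := Nat.exists_eq_add_of_le
      (show (σ k (A.last e).state).steps.length ≤ N by nlinarith)
    have hN' : j * (t + (n + n * n)) ≤ N' := by
      rw [add_mul, one_mul] at hN
      omega
    set p := A.execSteps (σ k (A.last e).state).steps e with hp
    let bad : Bool → Exec n Mem Msg → ℝ≥0∞ := fun b e' =>
      (A.PreValent t θ b j).indicator (fun _ => 1) (A.last e').state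
    have hbad : ∀ b, expect p (bad b) ≤ θ j := fun b => by
      refine le_trans (le_of_eq ?_) (hP b)
      rw [toOuterMeasure_eq_expect, ← A.map_state_execSteps_move _ e he.sent, expect_map]
    have hgood : ∀ e' ∈ p.support, 1 ≤
        ((A.runFrom (A.follow σ) N' e').toOuterMeasure {e'' | A.RunsUndecidedFor t m e''} +
          ∑ l ∈ Finset.range j, 2 * θ l) + (bad false e' + bad true e') := by
      intro e' he'
      by_cases hv : ∃ b, (A.last e').state ∈ A.PreValent t θ b j
      · obtain ⟨b, hb⟩ := hv
        have h1 : bad b e' = 1 := Set.indicator_of_mem hb _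
        refine le_trans ?_ le_add_self
        cases b
        · exact h1 ▸ le_self_add
        · exact h1 ▸ le_add_self
      · rw [not_exists] at hv
        exact (ih (k + 1) (by omega) e' (he.move ht hσ he')
          (hY _ (state_mem_support_next he.sent he') hv) N' hN').trans le_self_add
    have hsum := expect_mono hgood
    rw [expect_const, expect_add, expect_add, expect_add, expect_const] at hsum
    refine hsum.trans ?_
    rw [he.runFrom_eq N', toOuterMeasure_eq_expect (p.bind _), expect_bind,
      Finset.sum_range_succ, two_mul (θ j)]
    simp only [← toOuterMeasure_eq_expect]
    exact (add_le_add le_rfl (add_le_add (hbad false) (hbad true))).trans_eq (add_assoc _ _ _)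

/-- The failure probability that is tolerated, for each of the two values, in a window followed by `k`
further ones: `0` for the last window, and otherwise the least value for which concentration of
product measures separates the two values. -/
noncomputable def threshold (n t : ℕ) (k : ℕ) : ℝ≥0∞ :=
  if k = 0 then 0 else ENNReal.ofReal (Real.exp (-(t ^ 2 / (4 * n))))

theorem threshold_lt_one [NeZero n] (ht0 : 0 < t) (k : ℕ) : threshold n t k < 1 := by
  unfold threshold
  split_ifs
  · exact zero_lt_one
  · rw [ENNReal.ofReal_lt_one, Real.exp_lt_one_iff, neg_lt_zero]
    have : (0 : ℝ) < n := by exact_mod_cast Nat.pos_of_ne_zero (NeZero.ne n)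
    positivity

theorem threshold_mul_self (n t k : ℕ) :
    k = 0 ∨ ENNReal.ofReal (Real.exp (-(t ^ 2 / (2 * n)))) ≤ threshold n t k * threshold n t k := by
  rcases eq_or_ne k 0 with hk | hk
  · exact Or.inl hk
  · right
    simp only [threshold, hk, if_false]
    rw [← ENNReal.ofReal_mul (Real.exp_nonneg _), ← Real.exp_add]
    apply le_of_eq
    congr 2
    ring

theorem exists_adversary (ht : t < n) (ht0 : 0 < t) (hcorr : A.MeasureOneCorrectness t)
    (hterm : A.MeasureOneTermination t) (m : ℕ) (x : ℝ) (hx : x ≤ m) :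
    ∃ adv : Adversary n Mem Msg, A.IsStronglyAdaptive t adv ∧ ∃ inputs : Fin n → Bool,
      1 ≤ A.probRunningTimeAtLeast t adv inputs x +
        ∑ l ∈ Finset.range m, 2 * threshold n t l := by
  have : NeZero n := ⟨by omega⟩
  have hθ := threshold_lt_one (n := n) ht0
  have hsep := separated ht ht0 hcorr hterm hθ (threshold_mul_self n t)
  choose σ hlegal hzero hmove using
    exists_move hsep hθ ht0 (threshold_mul_self n t) m
  have hσ : Strategy.Legal t σ := ⟨hlegal, fun X => hzero 0 X rfl⟩
  obtain ⟨inputs, hin⟩ := (hsep m).exists_inputs ht ht0 hcorr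
  refine ⟨A.follow σ, isStronglyAdaptive_follow hσ, inputs, ?_⟩
  refine (one_le_prob_undecided_add ht hθ hσ hmove m 0 (zero_add m) (.start inputs)
    (windowBoundary_start inputs) ⟨∅, by simp, fun _ => rfl, ?_, ?_⟩ _ le_rfl).trans ?_
  · rw [resetStates_empty]; exact reach_initial inputs
  · rw [resetStates_empty]; exact hin
  · refine add_le_add ?_ le_rfl
    rw [← run_eq_runFrom]
    refine le_trans (MeasureTheory.measure_mono fun e he => ?_)
      (le_iSup (fun N => (A.run (A.follow σ) inputs N).toOuterMeasure
        {e | ∃ m : ℕ, x ≤ m ∧ A.RunsUndecidedFor t m e}) _)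
    exact ⟨m, hx, he⟩

/-- The total failure probability over `⌈y / 8⌉` windows. If there are several windows, their number is
at most `y / 4`, and each fails with probability at most `2 / y`. -/
theorem sum_threshold_le {n t : ℕ} {y : ℝ} (hy : 0 < y)
    (hyt : y ≤ Real.exp (t ^ 2 / (4 * n))) :
    ∑ l ∈ Finset.range ⌈1 / 8 * y⌉₊, 2 * threshold n t l ≤ 1 / 2 := by
  rcases le_or_gt y 8 with h8 | h8
  · -- there is only one window, and its threshold is `0`
    refine le_trans (le_of_eq (Finset.sum_eq_zero fun l hl => ?_)) zero_le
    have : ⌈1 / 8 * y⌉₊ ≤ 1 := Nat.ceil_le.2 (by push_cast; linarith)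
    have hl := Finset.mem_range.1 hl
    have : l = 0 := by omega
    simp [threshold, this]
  · have hm : (⌈1 / 8 * y⌉₊ : ℝ) ≤ y / 4 := by
      have := Nat.ceil_lt_add_one (show 0 ≤ 1 / 8 * y by linarith)
      linarith
    have hτ : Real.exp (-(t ^ 2 / (4 * n))) ≤ y⁻¹ := by
      rw [Real.exp_neg]
      exact inv_anti₀ hy hyt
    have hth : ∀ l, threshold n t l ≤ ENNReal.ofReal y⁻¹ := fun l => by
      unfold threshold
      split_ifs
      · exact zero_le
      · exact ENNReal.ofReal_le_ofReal hτ
    calc ∑ l ∈ Finset.range ⌈1 / 8 * y⌉₊, 2 * threshold n t l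
        ≤ ∑ _l ∈ Finset.range ⌈1 / 8 * y⌉₊, 2 * ENNReal.ofReal y⁻¹ :=
          Finset.sum_le_sum fun l _ => mul_le_mul_right (hth l) 2
      _ = ENNReal.ofReal (⌈1 / 8 * y⌉₊ * (2 * y⁻¹)) := by
          rw [Finset.sum_const, Finset.card_range, nsmul_eq_mul,
            ENNReal.ofReal_mul (by positivity), ENNReal.ofReal_mul (by norm_num)]
          simp
      _ ≤ ENNReal.ofReal (1 / 2) := by
          refine ENNReal.ofReal_le_ofReal ?_
          calc (⌈1 / 8 * y⌉₊ : ℝ) * (2 * y⁻¹) ≤ y / 4 * (2 * y⁻¹) :=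
                mul_le_mul_of_nonneg_right hm (by positivity)
            _ = 1 / 2 := by field_simp; norm_num
      _ = 1 / 2 := by
          rw [ENNReal.ofReal_div_of_pos (by norm_num)]
          simp

end Algorithm

end AsyncAgreement

theorem mainTheorem2 (c : ℝ) (hc : 0 < c) :
    ∃ C α : ℝ, 0 < C ∧ 0 < α ∧
      ∀ n t : ℕ, t = ⌊c * n⌋₊ → 0 < t → t < n →
      ∀ (Mem : Type*) (Msg : Type*) (A : AsyncAgreement.Algorithm n Mem Msg),
        A.MeasureOneCorrectness t → A.MeasureOneTermination t →
        ∃ adv : AsyncAgreement.Adversary n Mem Msg, A.IsStronglyAdaptive t adv ∧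
          ∃ inputs : Fin n → Bool,
            1 / 2 ≤ A.probRunningTimeAtLeast t adv inputs (C * Real.exp (α * n)) := by
  refine ⟨1 / 8, c ^ 2 / 16, by norm_num, by positivity, ?_⟩
  intro n t htc ht0 ht Mem Msg A hcorr hterm
  obtain ⟨adv, hadv, inputs, h⟩ := AsyncAgreement.Algorithm.exists_adversary ht ht0 hcorr hterm
    ⌈1 / 8 * Real.exp (c ^ 2 / 16 * n)⌉₊ _ (Nat.le_ceil _)
  refine ⟨adv, hadv, inputs, ?_⟩
  have hn : (0 : ℝ) < n := by exact_mod_cast ht0.trans ht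
  have hexp : Real.exp (c ^ 2 / 16 * n) ≤ Real.exp (t ^ 2 / (4 * n)) := by
    -- rounding `c * n` down to a positive integer loses at most a factor of `2`
    have h1 : c * n ≤ 2 * t := by
      have h2 : c * n < t + 1 := by rw [htc]; exact Nat.lt_floor_add_one _
      have h3 : (1 : ℝ) ≤ t := by exact_mod_cast ht0
      linarith
    have h4 : (c * n) ^ 2 ≤ (2 * t) ^ 2 := pow_le_pow_left₀ (by positivity) h1 2
    rw [Real.exp_le_exp, le_div_iff₀ (by positivity)]
    nlinarith
  have hsum := AsyncAgreement.Algorithm.sum_threshold_le (Real.exp_pos _) hexp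
  have h12 := tsub_le_iff_right.2 (h.trans (add_le_add le_rfl hsum))
  rwa [one_div, ENNReal.one_sub_inv_two, ← one_div] at h12
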